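/- **Dynamic $k$-Supplier with two time steps.** An instance consists of a metric space $(X,d)$, finite sets $C_1,C_2\subseteq X$ of clients, finite sets $F_1,F_2\subseteq X$ of candidate facility locations, a real number $B>0$ and an integer $k\ge 1$. A feasible solution is a pair of multisets $A_1,A_2$ with $|A_1|=|A_2|=k$ (counted with multiplicity), all elements of $A_t$ in $F_t$, such that there is a one-to-one matching between $A_1$ and $A_2$ in which every matched pair is at distance at most $B$. Its radius is $\max_{t\in\{1,2\}}\max_{j\in C_t} d(j,A_t)$, where $d(j,A)=\min_{i\in A}d(j,i)$ (the radius is $0$ if there are no clients), and $R^*$ denotes the minimum radius of a feasible solution. **Theorem.** There is a polynomial-time $3$-approximation algorithm for Dynamic $k$-Supplier with $T=2$. That is, there are a single program and a polynomial $q$ such that, on every instance, given by the number $k$, the bound $B$, the distance matrix of the $N$ points of $C_1\cup C_2\cup F_1\cup F_2$ and the membership tables of the four sets, the program halts after at most $q(N+\ell)$ steps, where $\ell$ is the binary length of $k$. If the instance has a feasible solution, the program outputs one (as multiplicities of the points in $A_1$ and $A_2$) of radius at most $3R^*$; otherwise it reports that there is none. Here a program is one for a random access machine whose memory consists of two-dimensional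 arrays of natural numbers and of real numbers, and whose unit-cost operations are reading and writing an entry, addition, truncated subtraction of natural numbers, comparison and branching (there is no multiplication and no real constant). -/

import Mathlib

open scoped NNReal ENNReal

universe u

/-! ## The Dynamic `k`-Supplier problem -/

/-- An instance of Dynamic `k`-Supplier with `T` time steps in the metric space `X`: finite sets
`C t` of clients and `F t` of candidate facility locations, a movement bound `B > 0` and a number
`k ≥ 1` of facilities. -/
structure DynamicKSupplier (X : Type*) [MetricSpace X] (T : ℕ) where
  two_le : 2 ≤ T
  C : Fin T → Finset X
  F : Fin T → Finset X
  B : ℝ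
  B_pos : 0 < B
  k : ℕ
  k_pos : 0 < k

namespace DynamicKSupplier

variable {X : Type*} [MetricSpace X] {T : ℕ} (I : DynamicKSupplier X T)

/-- `A` is a feasible solution: `A t` is a multiset of `k` locations from `F t`, and for
consecutive time steps there is a one-to-one matching between the two multisets in which matched
locations are at distance at most `B` (`Multiset.Rel r` says that the elements of two multisets,
counted with multiplicity, can be paired up so that every pair satisfies `r`). -/
def IsFeasible (A : Fin T → Multiset X) : Prop :=
  (∀ t, ∀ x ∈ A t, x ∈ I.F t) ∧
  (∀ t, (A t).card = I.k) ∧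
  ∀ t t' : Fin T, (t : ℕ) + 1 = t' → Multiset.Rel (fun x y => dist x y ≤ I.B) (A t) (A t')

/-- The maximum service distance `max_t max_{j ∈ C t} d(j, A t)`, where
`d(j, A) = min_{i ∈ A} d(j, i)`. It is `0` if there are no clients. -/
noncomputable def cost (A : Fin T → Multiset X) : ℝ≥0∞ :=
  ⨆ t, ⨆ j ∈ I.C t, ⨅ i ∈ A t, edist j i

/-- The optimal radius (`⊤` if there is no feasible solution). -/
noncomputable def opt : ℝ≥0∞ :=
  ⨅ (A : Fin T → Multiset X) (_ : I.IsFeasible A), I.cost A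

/-- `p` lists, without repetition, the points that are a client or a candidate location at some
time step. -/
def Enumerates {N : ℕ} (p : Fin N ↪ X) : Prop :=
  ∀ x, x ∈ Set.range p ↔ ∃ t, x ∈ I.C t ∨ x ∈ I.F t

end DynamicKSupplier

/-! ## Programs for a random access machine

The memory consists of two-dimensional arrays of natural numbers and two-dimensional arrays of real
numbers; every array has a fixed name, a natural number. The operations are reading and writing an
array entry at computed indices, addition, truncated subtraction of natural numbers, and comparison.
There are no real constants, there is no multiplication, rounding or conversion, and every
elementary operation costs one step. So a number grows by at most one bit per step, and on rational
inputs a polynomial number of steps is polynomial time on a Turing machine. -/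

namespace RAM

/-- The contents of the memory: entry `(i, j)` of the array of naturals (reals) with name `a` is
`nat a i j` (`real a i j`). -/
structure State where
  nat : ℕ → ℕ → ℕ → ℕ
  real : ℕ → ℕ → ℕ → ℝ

/-- Overwrite one entry of an array of natural numbers. -/
def State.setNat (s : State) (a i j v : ℕ) : State :=
  { s with nat := fun a' i' j' => if a' = a ∧ i' = i ∧ j' = j then v else s.nat a' i' j' }

/-- Overwrite one entry of an array of real numbers. -/
def State.setReal (s : State) (a i j : ℕ) (v : ℝ) : State :=
  { s with real := fun a' i' j' => if a' = a ∧ i' = i ∧ j' = j then v else s.real a' i' j' }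

/-- Expressions of type natural number. -/
inductive NatExpr where
  | const (n : ℕ)
  | read (a : ℕ) (i j : NatExpr)
  | add (e f : NatExpr)
  | sub (e f : NatExpr)

/-- The value of an expression in a state. -/
def NatExpr.eval (s : State) : NatExpr → ℕ
  | const n => n
  | read a i j => s.nat a (i.eval s) (j.eval s)
  | add e f => e.eval s + f.eval s
  | sub e f => e.eval s - f.eval s

/-- The number of elementary operations needed to evaluate an expression. -/
def NatExpr.cost : NatExpr → ℕ
  | const _ => 1
  | read _ i j => i.cost + j.cost + 1
  | add e f => e.cost + f.cost + 1
  | sub e f => e.cost + f.cost + 1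

/-- Expressions of type real number. -/
inductive RealExpr where
  | read (a : ℕ) (i j : NatExpr)
  | add (e f : RealExpr)

/-- The value of an expression in a state. -/
noncomputable def RealExpr.eval (s : State) : RealExpr → ℝ
  | read a i j => s.real a (i.eval s) (j.eval s)
  | add e f => e.eval s + f.eval s

/-- The number of elementary operations needed to evaluate an expression. -/
def RealExpr.cost : RealExpr → ℕ
  | read _ i j => i.cost + j.cost + 1
  | add e f => e.cost + f.cost + 1

/-- Conditions for branches and loops. -/
inductive Test where
  | natLE (e f : NatExpr)
  | realLE (e f : RealExpr)
  | not (b : Test)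
  | and (b c : Test)

/-- The condition holds in a state. -/
def Test.Holds (s : State) : Test → Prop
  | natLE e f => e.eval s ≤ f.eval s
  | realLE e f => e.eval s ≤ f.eval s
  | not b => ¬ b.Holds s
  | and b c => b.Holds s ∧ c.Holds s

/-- The number of elementary operations needed to check a condition. -/
def Test.cost : Test → ℕ
  | natLE e f => e.cost + f.cost + 1
  | realLE e f => e.cost + f.cost + 1
  | not b => b.cost + 1
  | and b c => b.cost + c.cost + 1

/-- Programs. -/
inductive Prog where
  | skip
  | setNat (a : ℕ) (i j e : NatExpr)
  | setReal (a : ℕ) (i j : NatExpr) (e : RealExpr)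
  | seq (P Q : Prog)
  | ite (b : Test) (P Q : Prog)
  | while (b : Test) (P : Prog)

/-- `Exec P s s' c`: started in state `s`, the program `P` halts in state `s'` after exactly `c`
steps. -/
inductive Exec : Prog → State → State → ℕ → Prop
  | skip (s : State) : Exec .skip s s 1
  | setNat (a : ℕ) (i j e : NatExpr) (s : State) :
      Exec (.setNat a i j e) s (s.setNat a (i.eval s) (j.eval s) (e.eval s))
        (i.cost + j.cost + e.cost + 1)
  | setReal (a : ℕ) (i j : NatExpr) (e : RealExpr) (s : State) :
      Exec (.setReal a i j e) s (s.setReal a (i.eval s) (j.eval s) (e.eval s))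
        (i.cost + j.cost + e.cost + 1)
  | seq {P Q : Prog} {s s' s'' : State} {c d : ℕ} :
      Exec P s s' c → Exec Q s' s'' d → Exec (.seq P Q) s s'' (c + d)
  | ite_true {b : Test} {P Q : Prog} {s s' : State} {c : ℕ} :
      b.Holds s → Exec P s s' c → Exec (.ite b P Q) s s' (b.cost + c)
  | ite_false {b : Test} {P Q : Prog} {s s' : State} {c : ℕ} :
      ¬ b.Holds s → Exec Q s s' c → Exec (.ite b P Q) s s' (b.cost + c)
  | while_true {b : Test} {P : Prog} {s s' s'' : State} {c d : ℕ} :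
      b.Holds s → Exec P s s' c → Exec (.while b P) s' s'' d →
        Exec (.while b P) s s'' (b.cost + c + d)
  | while_false {b : Test} {P : Prog} {s : State} :
      ¬ b.Holds s → Exec (.while b P) s s b.cost

end RAM

/-! ## Approximation algorithms for Dynamic `k`-Supplier -/

namespace DynamicKSupplier

open RAM

variable {X : Type*} [MetricSpace X] {T : ℕ} (I : DynamicKSupplier X T)

open Classical in
/-- The initial memory for the instance `I` whose points are listed by `p`. Arrays of naturals:
`0` holds the number `N` of points and `1` holds `k` (at position `(0, 0)`); `2` and `3` hold the
0-1 membership tables of the sets `C t` and `F t` (entry `(t, v)` for the point `p v`, time steps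
counted from `0`). Arrays of reals: `0` is the distance matrix, `1` holds `B` (at position
`(0, 0)`). All other entries are `0`. -/
noncomputable def input {N : ℕ} (p : Fin N ↪ X) : State where
  nat a i j :=
    match a with
    | 0 => if i = 0 ∧ j = 0 then N else 0
    | 1 => if i = 0 ∧ j = 0 then I.k else 0
    | 2 => if ∃ (t : Fin T) (v : Fin N), (t : ℕ) = i ∧ (v : ℕ) = j ∧ p v ∈ I.C t then 1 else 0
    | 3 => if ∃ (t : Fin T) (v : Fin N), (t : ℕ) = i ∧ (v : ℕ) = j ∧ p v ∈ I.F t then 1 else 0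
    | _ => 0
  real a i j :=
    match a with
    | 0 => if h : i < N ∧ j < N then dist (p ⟨i, h.1⟩) (p ⟨j, h.2⟩) else 0
    | 1 => if i = 0 ∧ j = 0 then I.B else 0
    | _ => 0

/-- The sequence of multisets described by a final memory: entry `(t, v)` of the array of naturals
`5` is the multiplicity of the point `p v` at time `t`. -/
def output {N : ℕ} (p : Fin N ↪ X) (s : State) (t : Fin T) : Multiset X :=
  ∑ v : Fin N, Multiset.replicate (s.nat 5 t v) (p v)

/-- The program `P` is a polynomial-time `α`-approximation algorithm for Dynamic `k`-Supplier with
`T` time steps: on every instance, it halts after a number of steps that is at most a fixed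
polynomial in the number of points plus the binary length of `k`; if the instance has a feasible
solution, it sets the flag (entry `(0, 0)` of the array of naturals `4`) to `1` and outputs a
feasible solution of cost at most `α` times the optimum; otherwise it leaves `0` in the flag. -/
def IsPolyTimeApprox (T : ℕ) (α : ℝ≥0) (P : Prog) : Prop :=
  ∃ q : Polynomial ℕ, ∀ (X : Type u) [MetricSpace X] (I : DynamicKSupplier X T)
    (N : ℕ) (p : Fin N ↪ X), I.Enumerates p →
    ∃ (s : State) (c : ℕ), Exec P (I.input p) s c ∧ c ≤ q.eval (N + Nat.size I.k) ∧
      ((∃ A, I.IsFeasible A) →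
        s.nat 4 0 0 = 1 ∧ I.IsFeasible (output p s) ∧ I.cost (output p s) ≤ α * I.opt) ∧
      ((¬ ∃ A, I.IsFeasible A) → s.nat 4 0 0 = 0)

end DynamicKSupplier

/-! Let `N` be the number of points. The algorithm tries every distance `r` as the radius,
including `0`.

For a fixed `r`, choose in both time steps greedily a maximal set of clients at pairwise distance
more than `2 * r`, the representatives. A location is within `r` of at most one representative of
its time step, and every client is within `2 * r` of a representative, so a solution that serves the
representatives within `r` serves all clients within `3 * r`. Call two representatives of the two
time steps adjacent if some permitted pair of locations (at distance at most `B`) serves both within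
`r`. One needs at most `k` permitted pairs that serve all representatives, that is, a minimum edge
cover of this bipartite graph, where a representative may also be covered alone; superfluous pairs
are copies of an arbitrary one.

A maximum matching, and with it a minimum edge cover, is found by an auction (`Auction`). Unmatched
representatives of the first time step bid one after the other for a cheapest neighbour, whose price
goes up by one and whose former owner has to bid again; a bidder that finds only neighbours of price
greater than `N` quits. The sum of the prices bounds the number of bids. Among the prices `0, …, N`
some level does not occur, and it splits the vertices in such a way that one gets an
independent set of the size of the edge cover (`Auction.exists_independent`). The vertices of an
independent set have to be served by distinct pairs (`Table.IsSolution.card_le`). So if there is a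
solution of radius `r`, the edge cover has at most `k` edges (`RAM.IsComputed.complete`), and
conversely a cover with at most `k` edges gives a solution of radius `3 * r`
(`RAM.IsComputed.sound`). The cost of a feasible solution is at least some distance `r` within
which it serves all clients (`DynamicKSupplier.exists_covers`), so the smallest successful `r` is at
most the optimum.

All loops of the algorithm run over `0, …, N`. Programs of this kind always halt, after a number of
steps that is polynomial in `N`, in a state given by a recursive function
(`RAM.Blk.exec_compile`); the correctness proof speaks about this function only. The index `N`,
which is not a point, has distance `0` in memory to everything. It is used as a client that any
location serves, which allows for covering a representative alone, and as a source of the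
radius `0`. -/

/-! ### A language of bounded loops -/

open RAM

namespace RAM

theorem State.setNat_nat (s : State) (a i j v a' i' j' : ℕ) :
    (s.setNat a i j v).nat a' i' j' = if a' = a ∧ i' = i ∧ j' = j then v else s.nat a' i' j' := rfl

theorem State.setNat_nat_of_ne (s : State) {a a' : ℕ} (i j v : ℕ) (h : a' ≠ a) :
    (s.setNat a i j v).nat a' = s.nat a' := by
  funext i' j'
  simp [State.setNat_nat, h]

/-- Programs without writes to real arrays in which the only loops are `loop x P`: the body `P` is
run for the values `0, …, N` of the scalar `x`, where `N` is the number in array `0`. -/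
inductive Blk where
  | skip
  | set (a : ℕ) (i j e : NatExpr)
  | seq (P Q : Blk)
  | ite (b : Test) (P Q : Blk)
  | loop (x : ℕ) (P : Blk)

/-- The scalar stored at position `(0, 0)` of the array `a`. -/
abbrev NatExpr.scalar (a : ℕ) : NatExpr := .read a (.const 0) (.const 0)

/-- Translation into programs; a bounded loop becomes a `while` loop that increments `x`. -/
def Blk.compile : Blk → Prog
  | skip => .skip
  | set a i j e => .setNat a i j e
  | seq P Q => .seq P.compile Q.compile
  | ite b P Q => .ite b P.compile Q.compile
  | loop x P =>
    .seq (.setNat x (.const 0) (.const 0) (.const 0))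
      (.while (.natLE (.scalar x) (.scalar 0))
        (.seq P.compile
          (.setNat x (.const 0) (.const 0) (.add (.scalar x) (.const 1)))))

/-- The state after `i` rounds of a loop over `x` whose body acts as `f`. -/
def iterate (x : ℕ) (f : State → State) (s : State) : ℕ → State
  | 0 => s.setNat x 0 0 0
  | i + 1 => (f (iterate x f s i)).setNat x 0 0 (i + 1)

open Classical in
/-- The final state of a program. -/
noncomputable def Blk.den : Blk → State → State
  | skip, s => s
  | set a i j e, s => s.setNat a (i.eval s) (j.eval s) (e.eval s)
  | seq P Q, s => Q.den (P.den s)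
  | ite b P Q, s => if b.Holds s then P.den s else Q.den s
  | loop x P, s => iterate x P.den s (s.nat 0 0 0 + 1)

/-- The arrays that a program may modify. -/
def Blk.writes : Blk → List ℕ
  | skip => []
  | set a _ _ _ => [a]
  | seq P Q => P.writes ++ Q.writes
  | ite _ P Q => P.writes ++ Q.writes
  | loop x P => x :: P.writes

/-- No loop body modifies its own loop variable. -/
def Blk.WellFormed : Blk → Prop
  | skip => True
  | set _ _ _ _ => True
  | seq P Q => P.WellFormed ∧ Q.WellFormed
  | ite _ P Q => P.WellFormed ∧ Q.WellFormed
  | loop x P => P.WellFormed ∧ x ∉ P.writes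

/-- A bound for the number of steps, as a polynomial in the loop bound `N`. -/
noncomputable def Blk.time : Blk → Polynomial ℕ
  | skip => 1
  | set _ i j e => Polynomial.C (i.cost + j.cost + e.cost + 1)
  | seq P Q => P.time + Q.time
  | ite b P Q => Polynomial.C b.cost + P.time + Q.time
  | loop _ P => (Polynomial.X + 1) * (P.time + 15) + 15

/-- `t` agrees with `s` on the real arrays and on all arrays of naturals outside the list `W`. -/
structure Agrees (W : List ℕ) (s t : State) : Prop where
  real : t.real = s.real
  nat : ∀ a, a ∉ W → t.nat a = s.nat a

theorem Agrees.refl (W : List ℕ) (s : State) : Agrees W s s := ⟨rfl, fun _ _ => rfl⟩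

theorem Agrees.trans {W : List ℕ} {s t r : State} (h : Agrees W s t) (h' : Agrees W t r) :
    Agrees W s r :=
  ⟨h'.real.trans h.real, fun a ha => (h'.nat a ha).trans (h.nat a ha)⟩

theorem Agrees.mono {W W' : List ℕ} {s t : State} (h : Agrees W s t) (hW : W ⊆ W') :
    Agrees W' s t :=
  ⟨h.real, fun a ha => h.nat a fun h' => ha (hW h')⟩

theorem agrees_setNat {W : List ℕ} {a : ℕ} (ha : a ∈ W) (s : State) (i j v : ℕ) :
    Agrees W s (s.setNat a i j v) :=
  ⟨rfl, fun _ ha' => s.setNat_nat_of_ne i j v fun h => ha' (h ▸ ha)⟩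

theorem iterate_agrees {W : List ℕ} {x : ℕ} {f : State → State} (hx : x ∈ W)
    (hf : ∀ s, Agrees W s (f s)) (s : State) (i : ℕ) : Agrees W s (iterate x f s i) := by
  induction i with
  | zero => exact agrees_setNat hx s _ _ _
  | succ i ih => exact (ih.trans (hf _)).trans (agrees_setNat hx _ _ _ _)

theorem Blk.agrees (P : Blk) (s : State) : Agrees P.writes s (P.den s) := by
  induction P generalizing s with
  | skip => exact .refl _ _
  | set a i j e => exact agrees_setNat (by simp [writes]) _ _ _ _
  | seq P Q hP hQ =>
    exact ((hP s).mono (List.subset_append_left _ _)).trans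
      ((hQ _).mono (List.subset_append_right _ _))
  | ite b P Q hP hQ =>
    simp only [den, writes]
    split_ifs
    · exact (hP s).mono (List.subset_append_left _ _)
    · exact (hQ s).mono (List.subset_append_right _ _)
  | loop x P hP =>
    exact iterate_agrees (by simp) (fun t => (hP t).mono (List.subset_cons_self _ _)) s _

theorem iterate_counter (x : ℕ) (f : State → State) (s : State) (i : ℕ) :
    (iterate x f s i).nat x 0 0 = i := by
  cases i <;> simp [iterate, State.setNat_nat]

theorem iterate_bound {x : ℕ} {P : Blk} (hx : 0 ≠ x) (h0 : 0 ∉ P.writes) (s : State) (i : ℕ) :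
    (iterate x P.den s i).nat 0 = s.nat 0 :=
  (iterate_agrees (W := x :: P.writes) (by simp)
    (fun t => (P.agrees t).mono (List.subset_cons_self _ _)) s i).nat 0 (by simp [h0, hx])

/-- The compiled program computes `den` within the announced number of steps. -/
theorem Blk.exec_compile {P : Blk} (hP : P.WellFormed) (h0 : 0 ∉ P.writes) {M : ℕ}
    (s : State) (hs : s.nat 0 0 0 ≤ M) :
    ∃ c, Exec P.compile s (P.den s) c ∧ c ≤ P.time.eval M := by
  induction P generalizing s with
  | skip => exact ⟨1, .skip s, by simp [time]⟩
  | set a i j e => exact ⟨_, .setNat a i j e s, by simp [time]⟩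
  | seq P Q ihP ihQ =>
    obtain ⟨h1, h2⟩ := hP
    rw [writes, List.mem_append, not_or] at h0
    obtain ⟨c, hc, hc'⟩ := ihP h1 h0.1 s hs
    obtain ⟨d, hd, hd'⟩ := ihQ h2 h0.2 (P.den s) (by rwa [(P.agrees s).nat 0 h0.1])
    exact ⟨_, .seq hc hd, by simp only [time, Polynomial.eval_add]; omega⟩
  | ite b P Q ihP ihQ =>
    obtain ⟨h1, h2⟩ := hP
    rw [writes, List.mem_append, not_or] at h0
    by_cases hb : b.Holds s
    · obtain ⟨c, hc, hc'⟩ := ihP h1 h0.1 s hs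
      exact ⟨_, by simpa [den, hb] using .ite_true hb hc, by
        simp only [time, Polynomial.eval_add, Polynomial.eval_C]; omega⟩
    · obtain ⟨c, hc, hc'⟩ := ihQ h2 h0.2 s hs
      exact ⟨_, by simpa [den, hb] using .ite_false hb hc, by
        simp only [time, Polynomial.eval_add, Polynomial.eval_C]; omega⟩
  | loop x P ih =>
    obtain ⟨h1, hxP⟩ := hP
    rw [writes, List.mem_cons, not_or] at h0
    obtain ⟨hx, h0⟩ := h0
    set K := P.time.eval M with hK
    -- Induction on the number of remaining rounds.
    have key : ∀ m i, i + m = s.nat 0 0 0 + 1 → ∃ c,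
        Exec (.while (.natLE (.scalar x) (.scalar 0)) (.seq P.compile
          (.setNat x (.const 0) (.const 0) (.add (.scalar x) (.const 1)))))
          (iterate x P.den s i) (iterate x P.den s (s.nat 0 0 0 + 1)) c ∧
          c ≤ m * (K + 15) + 7 := by
      intro m
      induction m with
      | zero =>
        intro i hi
        obtain rfl : i = s.nat 0 0 0 + 1 := by omega
        refine ⟨_, .while_false ?_, ?_⟩
        · simp only [Test.Holds, NatExpr.eval, iterate_counter, iterate_bound hx h0]
          omega
        · simp [Test.cost, NatExpr.cost]
      | succ m ihm =>
        intro i hi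
        obtain ⟨d, hd, hd'⟩ := ihm (i + 1) (by omega)
        obtain ⟨c, hc, hc'⟩ := ih h1 h0 (iterate x P.den s i) (by rwa [iterate_bound hx h0])
        have hset := Exec.setNat x (.const 0) (.const 0) (.add (.scalar x) (.const 1))
          (P.den (iterate x P.den s i))
        have he : (NatExpr.add (.scalar x) (.const 1)).eval (P.den (iterate x P.den s i))
            = i + 1 := by
          simp only [NatExpr.eval, (P.agrees _).nat x hxP, iterate_counter]
        rw [he] at hset
        refine ⟨_, .while_true ?_ (.seq hc hset) hd, ?_⟩
        · simp only [Test.Holds, NatExpr.eval, iterate_counter, iterate_bound hx h0]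
          omega
        · simp only [Test.cost, NatExpr.cost]
          rw [Nat.succ_mul]
          omega
    obtain ⟨c, hc, hc'⟩ := key (s.nat 0 0 0 + 1) 0 (by omega)
    refine ⟨_, .seq (.setNat x _ _ _ s) hc, ?_⟩
    have : (s.nat 0 0 0 + 1) * (K + 15) ≤ (M + 1) * (K + 15) := by gcongr
    simp only [time, Polynomial.eval_add, Polynomial.eval_mul, Polynomial.eval_X,
      Polynomial.eval_one, Polynomial.eval_ofNat, NatExpr.cost, ← hK]
    omega

/-- The induction principle for a loop `L`: an invariant that does not mention the loop variable. -/
theorem Blk.den_loop_induction {L P : Blk} {x : ℕ} (hL : L = .loop x P) {s : State} {N : ℕ}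
    (hN : s.nat 0 0 0 = N) (Inv : ℕ → State → Prop)
    (hx : ∀ i t v, Inv i t → Inv i (t.setNat x 0 0 v)) (h0 : Inv 0 s)
    (step : ∀ i ≤ N, ∀ t, Agrees L.writes s t → t.nat x 0 0 = i → Inv i t →
      Inv (i + 1) (P.den t)) :
    Inv (N + 1) (L.den s) := by
  subst hN hL
  have key : ∀ i ≤ s.nat 0 0 0 + 1, Inv i (iterate x P.den s i) := by
    intro i hi
    induction i with
    | zero => exact hx _ _ _ h0
    | succ i ih =>
      exact hx _ _ _ (step i (by omega) _ (iterate_agrees (by simp)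
        (fun t => (P.agrees t).mono (List.subset_cons_self _ _)) s i) (iterate_counter ..)
        (ih (by omega)))
  exact key _ le_rfl

/-- The induction principle for two nested loops. -/
theorem Blk.den_loop₂_induction {L P : Blk} {x y : ℕ} (hL : L = .loop x (.loop y P)) {s : State}
    {N : ℕ} (hN : s.nat 0 0 0 = N) (hwf : L.WellFormed) (h0 : 0 ∉ L.writes)
    (Inv : ℕ → ℕ → State → Prop)
    (hx : ∀ i j t v, Inv i j t → Inv i j (t.setNat x 0 0 v))
    (hy : ∀ i j t v, Inv i j t → Inv i j (t.setNat y 0 0 v)) (hs : Inv 0 0 s)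
    (next : ∀ i ≤ N, ∀ t, Inv i (N + 1) t → Inv (i + 1) 0 t)
    (step : ∀ i ≤ N, ∀ j ≤ N, ∀ t, Agrees L.writes s t → t.nat x 0 0 = i → t.nat y 0 0 = j →
      Inv i j t → Inv i (j + 1) (P.den t)) :
    Inv (N + 1) 0 (L.den s) := by
  refine den_loop_induction hL hN (fun i t => Inv i 0 t) (fun i t v => hx i 0 t v) hs ?_
  intro i hi t ht htx hinv
  have hsub : (Blk.loop y P).writes ⊆ L.writes := hL ▸ List.subset_cons_self _ _
  refine next i hi _ (den_loop_induction rfl (by rw [ht.nat 0 h0, hN]) (Inv i) (hy i) hinv ?_)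
  intro j hj t' ht' hty hinv'
  refine step i hi j hj t' (ht.trans (ht'.mono hsub)) ?_ hty hinv'
  rw [ht'.nat x, htx]
  rw [hL] at hwf
  exact hwf.2

end RAM

/-! ### The auction -/

/-- The invariants of the auction for a maximum matching in the bipartite graph `adj` between
the entered bidders `E` and the objects `R`, all numbered below `N`. Here `p v` is the price of `v`,
`own v` its owner (`N` if there is none), `g` is positive at the bidders that have quit, and `cur`
is the bidder whose turn it is (`N` if there is none). -/
structure Auction (N : ℕ) (R : ℕ → Prop) (adj : ℕ → ℕ → Prop) (E : ℕ → Prop) (cur : ℕ)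
    (p own g : ℕ → ℕ) : Prop where
  entered_lt : ∀ u, E u → u < N
  price_le : ∀ v < N, p v ≤ N + 1
  owned_of_price : ∀ v < N, 0 < p v → own v ≠ N
  owner : ∀ v < N, own v ≠ N → R v ∧ E (own v) ∧ adj (own v) v ∧
    ∀ w < N, R w → adj (own v) w → p v ≤ p w + 1
  inj : ∀ v < N, ∀ v' < N, own v ≠ N → own v = own v' → v = v'
  quit : ∀ u ≤ N, 0 < g u → E u ∧ (∀ w < N, R w → adj u w → N < p w) ∧ ∀ v < N, own v ≠ u
  cur_spec : cur ≠ N → E cur ∧ g cur = 0 ∧ ∀ v < N, own v ≠ cur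
  total : ∀ u, E u → cur = u ∨ 0 < g u ∨ ∃ v < N, own v = u

namespace Auction

variable {N : ℕ} {R : ℕ → Prop} {adj : ℕ → ℕ → Prop} {E : ℕ → Prop} {cur : ℕ} {p own g : ℕ → ℕ}

/-- The empty matching. -/
theorem init (hp : ∀ v ≤ N, p v = 0) (ho : ∀ v ≤ N, own v = N) (hg : ∀ v ≤ N, g v = 0) :
    Auction N R adj (fun _ => False) N p own g where
  entered_lt := by simp
  price_le v hv := by simp [hp v hv.le]
  owned_of_price v hv h := by simp [hp v hv.le] at h
  owner v hv h := (h (ho v hv.le)).elim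
  inj v hv _ _ h := (h (ho v hv.le)).elim
  quit u hu h := by simp [hg u hu] at h
  cur_spec h := (h rfl).elim
  total := by simp

theorem congr_entered {E' : ℕ → Prop} (h : Auction N R adj E cur p own g) (hE : ∀ u, E u ↔ E' u) :
    Auction N R adj E' cur p own g := by
  obtain rfl : E = E' := funext fun u => propext (hE u)
  exact h

/-- A new bidder enters, after the previous turn has ended. -/
theorem enter (h : Auction N R adj E N p own g) {u : ℕ} (hu : u < N) (hE : ¬ E u) :
    Auction N R adj (fun w => E w ∨ w = u) u p own g where
  entered_lt := by rintro w (hw | rfl); exacts [h.entered_lt w hw, hu]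
  price_le := h.price_le
  owned_of_price := h.owned_of_price
  owner v hv hv' := by
    obtain ⟨h1, h2, h3⟩ := h.owner v hv hv'
    exact ⟨h1, .inl h2, h3⟩
  inj := h.inj
  quit w hw hw' := ⟨.inl (h.quit w hw hw').1, (h.quit w hw hw').2⟩
  cur_spec _ := by
    refine ⟨.inr rfl, ?_, fun v hv hvu => ?_⟩
    · by_contra hg
      exact hE (h.quit u hu.le (Nat.pos_of_ne_zero hg)).1
    · exact hE (hvu ▸ (h.owner v hv (by omega)).2.1)
  total := by
    rintro w (hw | rfl)
    · rcases h.total w hw with rfl | h'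
      · exact absurd (h.entered_lt _ hw) (lt_irrefl _)
      · exact .inr h'
    · exact .inl rfl

/-- The bidder takes over a cheapest neighbour `v`; the former owner is next. -/
theorem bid (h : Auction N R adj E cur p own g) (hcur : cur ≠ N) {v : ℕ} (hv : v < N) (hR : R v)
    (hadj : adj cur v) (hp : p v ≤ N) (hmin : ∀ w < N, R w → adj cur w → p v ≤ p w) :
    Auction N R adj E (own v) (Function.update p v (p v + 1)) (Function.update own v cur) g := by
  obtain ⟨hc1, hc2, hc3⟩ := h.cur_spec hcur
  have hmono : ∀ w, p w ≤ Function.update p v (p v + 1) w := by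
    intro w
    rcases eq_or_ne w v with rfl | hw <;> simp [*]
  refine ⟨h.entered_lt, ?_, ?_, ?_, ?_, ?_, ?_, ?_⟩
  · intro w hw
    rcases eq_or_ne w v with rfl | hwv
    · simpa using hp
    · simpa [hwv] using h.price_le w hw
  · intro w hw
    rcases eq_or_ne w v with rfl | hwv
    · simpa using hcur
    · simpa [hwv] using h.owned_of_price w hw
  · intro w hw
    rcases eq_or_ne w v with rfl | hwv
    · intro _
      simp only [Function.update_self]
      exact ⟨hR, hc1, hadj, fun z hz hRz hz' =>
        Nat.succ_le_succ ((hmin z hz hRz hz').trans (hmono z))⟩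
    · simp only [Function.update_of_ne hwv]
      intro hw'
      obtain ⟨h1, h2, h3, h4⟩ := h.owner w hw hw'
      exact ⟨h1, h2, h3, fun z hz hRz hz' =>
        (h4 z hz hRz hz').trans (Nat.succ_le_succ (hmono z))⟩
  · intro w hw w' hw'
    by_cases hwv : w = v <;> by_cases hwv' : w' = v
    · exact fun _ _ => hwv.trans hwv'.symm
    · simp only [hwv, Function.update_self, Function.update_of_ne hwv']
      exact fun _ h' => (hc3 w' hw' h'.symm).elim
    · simp only [hwv', Function.update_self, Function.update_of_ne hwv]
      exact fun _ h' => (hc3 w hw h').elim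
    · simp only [Function.update_of_ne hwv, Function.update_of_ne hwv']
      exact h.inj w hw w' hw'
  · intro u hu hgu
    obtain ⟨h1, h2, h3⟩ := h.quit u hu hgu
    refine ⟨h1, fun w hw hRw hw' => (h2 w hw hRw hw').trans_le (hmono w), fun w hw => ?_⟩
    rcases eq_or_ne w v with rfl | hwv
    · rintro h'
      simp only [Function.update_self] at h'
      subst h'
      omega
    · simpa [hwv] using h3 w hw
  · intro hne
    refine ⟨(h.owner v hv hne).2.1, ?_, fun w hw => ?_⟩
    · by_contra hg
      have hlt := h.entered_lt _ (h.owner v hv hne).2.1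
      exact (h.quit _ hlt.le (Nat.pos_of_ne_zero hg)).2.2 v hv rfl
    · rcases eq_or_ne w v with rfl | hwv
      · simpa using (hc3 w hw).symm
      · simp only [Function.update_of_ne hwv]
        exact fun h' => hwv (h.inj v hv w hw hne h'.symm).symm
  · intro u hu
    rcases h.total u hu with rfl | h' | ⟨w, hw, rfl⟩
    · exact .inr (.inr ⟨v, hv, by simp⟩)
    · exact .inr (.inl h')
    · rcases eq_or_ne w v with rfl | hwv
      · exact .inl rfl
      · exact .inr (.inr ⟨w, hw, by simp [hwv]⟩)

/-- A bidder with only expensive neighbours quits. As prices never fall, this is final. -/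
theorem giveUp (h : Auction N R adj E cur p own g) (hcur : cur ≠ N)
    (hmin : ∀ w < N, R w → adj cur w → N < p w) :
    Auction N R adj E N p own (Function.update g cur 1) := by
  obtain ⟨hc1, hc2, hc3⟩ := h.cur_spec hcur
  refine ⟨h.entered_lt, h.price_le, h.owned_of_price, h.owner, h.inj, ?_, fun h' => (h' rfl).elim,
    ?_⟩
  · intro u hu
    rcases eq_or_ne u cur with rfl | huc
    · exact fun _ => ⟨hc1, hmin, hc3⟩
    · simpa [huc] using h.quit u hu
  · intro u hu
    rcases eq_or_ne u cur with rfl | huc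
    · simp
    · rcases h.total u hu with rfl | h'
      · exact (huc rfl).elim
      · exact .inr (by simpa [huc] using h')

/-- At the end of the auction the graph has an independent set with as many vertices as there are
objects and bidders that quit. Choose a price level `l ≤ N` that does not occur, and take the
objects below this level, the owners of the objects above it, and the bidders that quit: a bidder in
this set has only neighbours whose price is at least `l`, so their price is above `l`. -/
theorem exists_independent [DecidablePred R] (h : Auction N R adj E N p own g) :
    ∃ Z W : Finset ℕ, (∀ u ∈ Z, E u) ∧ (∀ w ∈ W, w < N ∧ R w) ∧ (∀ u ∈ Z, ∀ w ∈ W, ¬ adj u w) ∧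
      Z.card + W.card = ((Finset.range (N + 1)).filter fun v => 0 < g v).card +
        ((Finset.range N).filter R).card := by
  obtain ⟨l, hl, hl'⟩ : ∃ l ∈ Finset.range (N + 1), l ∉ (Finset.range N).image p :=
    Finset.exists_mem_notMem_of_card_lt_card (lt_of_le_of_lt Finset.card_image_le (by simp))
  have hlev : ∀ v < N, p v ≠ l := fun v hv hvl =>
    hl' (Finset.mem_image.2 ⟨v, Finset.mem_range.2 hv, hvl⟩)
  rw [Finset.mem_range] at hl
  set G := (Finset.range (N + 1)).filter fun v => 0 < g v
  set Y := ((Finset.range N).filter R).filter fun v => l < p v with hY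
  have hYmem : ∀ v ∈ Y, v < N ∧ R v ∧ l < p v ∧ own v ≠ N := by
    intro v hv
    simp only [hY, Finset.mem_filter, Finset.mem_range] at hv
    exact ⟨hv.1.1, hv.1.2, hv.2, h.owned_of_price v hv.1.1 (by omega)⟩
  have hGmem : ∀ u ∈ G, u ≤ N ∧ 0 < g u := by
    intro u hu
    simpa [G, Nat.lt_succ_iff] using hu
  have hdisj : Disjoint (Y.image own) G := by
    rw [Finset.disjoint_left]
    intro u hu hu'
    obtain ⟨v, hv, rfl⟩ := Finset.mem_image.1 hu
    exact (h.quit _ (hGmem _ hu').1 (hGmem _ hu').2).2.2 v (hYmem v hv).1 rfl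
  have hcard : (Y.image own).card = Y.card := Finset.card_image_of_injOn fun v hv w hw hvw =>
    h.inj v (hYmem v hv).1 w (hYmem w hw).1 (hYmem v hv).2.2.2 hvw
  refine ⟨Y.image own ∪ G, ((Finset.range N).filter R).filter fun v => ¬ l < p v, ?_, ?_, ?_, ?_⟩
  · intro u hu
    rcases Finset.mem_union.1 hu with hu | hu
    · obtain ⟨v, hv, rfl⟩ := Finset.mem_image.1 hu
      exact (h.owner v (hYmem v hv).1 (hYmem v hv).2.2.2).2.1
    · exact (h.quit u (hGmem u hu).1 (hGmem u hu).2).1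
  · intro w hw
    simp only [Finset.mem_filter, Finset.mem_range] at hw
    exact hw.1
  · intro u hu w hw hadj
    simp only [Finset.mem_filter, Finset.mem_range] at hw
    have hwl := hlev w hw.1.1
    rcases Finset.mem_union.1 hu with hu | hu
    · obtain ⟨v, hv, rfl⟩ := Finset.mem_image.1 hu
      have h1 := (h.owner v (hYmem v hv).1 (hYmem v hv).2.2.2).2.2.2 w hw.1.1 hw.1.2 hadj
      have h2 := (hYmem v hv).2.2.1
      omega
    · have h1 := (h.quit u (hGmem u hu).1 (hGmem u hu).2).2.1 w hw.1.1 hw.1.2 hadj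
      omega
  · have hsplit : Y.card + _ = _ := Finset.card_filter_add_card_filter_not
      (s := (Finset.range N).filter R) (fun v => l < p v)
    rw [Finset.card_union_of_disjoint hdisj, hcard]
    omega

end Auction

/-! ### Instances as tables -/

/-- An instance with two time steps, with the points numbered from `0` to `N - 1`. The time steps
are `0` and `1`. -/
structure Table where
  N : ℕ
  k : ℕ
  C : ℕ → ℕ → Prop
  F : ℕ → ℕ → Prop
  D : ℕ → ℕ → ℝ
  B : ℝ

namespace Table

variable (T : Table)

/-- The distances of a table form a metric on its points. The index `N` is not a point; being at
distance `0` from everything, it serves as a client that any location serves. -/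
structure Metric : Prop where
  client_lt : ∀ t v, T.C t v → v < T.N
  site_lt : ∀ t v, T.F t v → v < T.N
  self : ∀ v, T.D v v = 0
  symm : ∀ v w, T.D v w = T.D w v
  triangle : ∀ u < T.N, ∀ v < T.N, ∀ w < T.N, T.D u w ≤ T.D u v + T.D v w
  nonneg : ∀ v w, 0 ≤ T.D v w
  dummy : ∀ v, T.D T.N v = 0

/-- The pair of locations `(i, j)` may be used and serves the client `u` in the first time step
and the client `v` in the second one, within distance `r`. -/
def Serves (r : ℝ) (u v i j : ℕ) : Prop :=
  T.F 0 i ∧ T.F 1 j ∧ T.D i j ≤ T.B ∧ T.D u i ≤ r ∧ T.D v j ≤ r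

/-- The pairs in `Q` form a feasible solution of radius at most `r`. -/
structure IsSolution (r : ℝ) (Q : Multiset (ℕ × ℕ)) : Prop where
  card : Q.card = T.k
  allowed : ∀ q ∈ Q, T.F 0 q.1 ∧ T.F 1 q.2 ∧ T.D q.1 q.2 ≤ T.B
  fst : ∀ c, T.C 0 c → ∃ q ∈ Q, T.D c q.1 ≤ r
  snd : ∀ c, T.C 1 c → ∃ q ∈ Q, T.D c q.2 ≤ r

/-- `S` consists of the clients of time step `t` chosen greedily in their order, such that the
distances between chosen clients exceed `r + r`. -/
def IsNet (r : ℝ) (t : ℕ) (S : ℕ → Prop) : Prop :=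
  ∀ v ≤ T.N, S v ↔ T.C t v ∧ ∀ w < v, S w → r + r < T.D v w

variable {T} {r : ℝ} {t : ℕ} {S : ℕ → Prop}

theorem IsNet.client (h : T.IsNet r t S) {v : ℕ} (hv : v ≤ T.N) (hS : S v) : T.C t v :=
  ((h v hv).1 hS).1

theorem IsNet.lt (hT : T.Metric) (h : T.IsNet r t S) {v : ℕ} (hv : v ≤ T.N) (hS : S v) : v < T.N :=
  hT.client_lt t v (h.client hv hS)

theorem IsNet.separated (hT : T.Metric) (h : T.IsNet r t S) {v w : ℕ} (hv : v ≤ T.N) (hw : w ≤ T.N)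
    (hSv : S v) (hSw : S w) (hvw : v ≠ w) : r + r < T.D v w := by
  rcases hvw.lt_or_gt with hlt | hlt
  · rw [hT.symm]
    exact ((h w hw).1 hSw).2 v hlt hSv
  · exact ((h v hv).1 hSv).2 w hlt hSw

theorem IsNet.cover (hT : T.Metric) (h : T.IsNet r t S) (hr : 0 ≤ r) {c : ℕ} (hc : T.C t c) :
    ∃ v < T.N, S v ∧ T.D c v ≤ r + r := by
  have hcN := hT.client_lt t c hc
  by_cases hS : S c
  · exact ⟨c, hcN, hS, by rw [hT.self]; linarith⟩
  · rw [h c hcN.le] at hS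
    push Not at hS
    obtain ⟨w, hw, hSw, hd⟩ := hS hc
    exact ⟨w, hw.trans hcN, hSw, hd⟩

/-- A location is within distance `r` of at most one client of the net. -/
theorem IsNet.eq_of_near (hT : T.Metric) (h : T.IsNet r t S) {v w i : ℕ} (hv : v ≤ T.N)
    (hw : w ≤ T.N) (hSv : S v) (hSw : S w) (hi : i < T.N) (hvi : T.D v i ≤ r) (hwi : T.D w i ≤ r) :
    v = w := by
  by_contra hvw
  have h1 := h.separated hT hv hw hSv hSw hvw
  have h2 := hT.triangle v (h.lt hT hv hSv) i hi w (h.lt hT hw hSw)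
  rw [hT.symm i w] at h2
  linarith

/-- An independent set of net clients needs as many pairs of locations as it has vertices. -/
theorem IsSolution.card_le (hT : T.Metric) {Q : Multiset (ℕ × ℕ)} (hQ : T.IsSolution r Q)
    {S₀ S₁ : ℕ → Prop} (h₀ : T.IsNet r 0 S₀) (h₁ : T.IsNet r 1 S₁) {Z W : Finset ℕ}
    (hZ : ∀ u ∈ Z, u ≤ T.N ∧ S₀ u) (hW : ∀ w ∈ W, w ≤ T.N ∧ S₁ w)
    (hind : ∀ u ∈ Z, ∀ w ∈ W, ∀ i j, ¬ T.Serves r u w i j) : Z.card + W.card ≤ T.k := by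
  classical
  have hf : ∀ u ∈ Z, ∃ q ∈ Q, T.D u q.1 ≤ r := fun u hu =>
    hQ.fst u (h₀.client (hZ u hu).1 (hZ u hu).2)
  have hg : ∀ w ∈ W, ∃ q ∈ Q, T.D w q.2 ≤ r := fun w hw =>
    hQ.snd w (h₁.client (hW w hw).1 (hW w hw).2)
  choose! f hf hf' using hf
  choose! g hg hg' using hg
  have hfi : (Z.image f).card = Z.card := Finset.card_image_of_injOn fun u hu v hv huv =>
    h₀.eq_of_near hT (hZ u hu).1 (hZ v hv).1 (hZ u hu).2 (hZ v hv).2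
      (hT.site_lt _ _ (hQ.allowed _ (hf u hu)).1) (hf' u hu) (by
        have := hf' v hv
        rwa [← huv] at this)
  have hgi : (W.image g).card = W.card := Finset.card_image_of_injOn fun u hu v hv huv =>
    h₁.eq_of_near hT (hW u hu).1 (hW v hv).1 (hW u hu).2 (hW v hv).2
      (hT.site_lt _ _ (hQ.allowed _ (hg u hu)).2.1) (hg' u hu) (by
        have := hg' v hv
        rwa [← huv] at this)
  have hdisj : Disjoint (Z.image f) (W.image g) := by
    rw [Finset.disjoint_left]
    intro q hq hq'
    obtain ⟨u, hu, rfl⟩ := Finset.mem_image.1 hq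
    obtain ⟨w, hw, huw⟩ := Finset.mem_image.1 hq'
    obtain ⟨h1, h2, h3⟩ := hQ.allowed _ (hf u hu)
    exact hind u hu w hw _ _ ⟨h1, h2, h3, hf' u hu, huw ▸ hg' w hw⟩
  rw [← hfi, ← hgi, ← Finset.card_union_of_disjoint hdisj, ← hQ.card]
  refine (Finset.card_le_card ?_).trans Q.toFinset_card_le
  intro q hq
  rw [Multiset.mem_toFinset]
  rcases Finset.mem_union.1 hq with hq | hq
  · obtain ⟨u, hu, rfl⟩ := Finset.mem_image.1 hq
    exact hf u hu
  · obtain ⟨u, hu, rfl⟩ := Finset.mem_image.1 hq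
    exact hg u hu

end Table

/-! ### The program -/

namespace RAM

/-! Names of the arrays of naturals; a scalar is stored at position `(0, 0)`. -/

-- The input: number of points, number of facilities, membership tables.
local notation "mN" => 0
local notation "mK" => 1
local notation "mClient" => 2
local notation "mSite" => 3
-- The output: feasibility flag and multiplicities.
local notation "mFlag" => 4
local notation "mOut" => 5
-- Marks of the representatives; adjacency, with the two locations of a pair serving both vertices.
local notation "mRep" => 6
local notation "mAdj" => 7
local notation "mFst" => 8
local notation "mSnd" => 9
-- The auction: prices and owners of the objects, marks of the bidders that have quit, the bidder
-- whose turn it is, and the best price and object found for it.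
local notation "mPrice" => 10
local notation "mOwner" => 11
local notation "mQuit" => 12
local notation "mCur" => 13
local notation "mBestPrice" => 14
local notation "mBest" => 15
-- Size of the edge cover, and whether some edge of it cannot be served.
local notation "mCount" => 16
local notation "mBad" => 17
-- Indices of the best radius found before.
local notation "mRowOpt" => 18
local notation "mColOpt" => 19
-- Loop variables (the first two are the indices of the current radius) and an auxiliary scalar.
local notation "vRow" => 20
local notation "vCol" => 21
local notation "vI" => 22
local notation "vJ" => 23
local notation "vP" => 24
local notation "vQ" => 25
local notation "mTmp" => 26

open NatExpr

/-- `x := e` for a scalar `x`. -/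
abbrev Blk.assign (x : ℕ) (e : NatExpr) : Blk := .set x (const 0) (const 0) e

/-- The test `0 < e`. -/
abbrev Test.pos (e : NatExpr) : Test := .natLE (.const 1) e

/-- The test `e < f`. -/
abbrev Test.lt (e f : NatExpr) : Test := .natLE (.add e (.const 1)) f

/-- The distance between two points. -/
abbrev distExpr (e f : NatExpr) : RealExpr := .read 0 e f

/-- The current guess of the radius. -/
abbrev radiusExpr : RealExpr := distExpr (.scalar vRow) (.scalar vCol)

/-- The test that the point `vJ` comes before `vI`, is marked, and is at distance at most twice
the radius from it. -/
def closeTest (t : ℕ) : Test :=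
  .and (.lt (scalar vJ) (scalar vI)) (.and (.pos (.read mRep (const t) (scalar vJ)))
    (.realLE (distExpr (scalar vI) (scalar vJ)) (.add radiusExpr radiusExpr)))

/-- Clear `mTmp` if the point `vI` is close to a point marked before. -/
def closeBlk (t : ℕ) : Blk :=
  .loop vJ (.ite (closeTest t) (.assign mTmp (const 0)) .skip)

/-- Mark the representatives among the clients of time step `t`: a client is marked if it is at
distance more than twice the radius from all clients marked before. -/
def repsBlk (t : ℕ) : Blk :=
  .loop vI (.seq (.assign mTmp (.read mClient (const t) (scalar vI)))
    (.seq (closeBlk t) (.set mRep (const t) (scalar vI) (scalar mTmp))))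

/-- The test that the pair of locations `(vP, vQ)` may be used, and serves the client `vI` in the
first and the client `vJ` in the second time step. -/
def servesTest : Test :=
  .and (.pos (.read mSite (const 0) (scalar vP))) (.and (.pos (.read mSite (const 1) (scalar vQ)))
    (.and (.realLE (distExpr (scalar vP) (scalar vQ)) (.read 1 (const 0) (const 0)))
      (.and (.realLE (distExpr (scalar vI) (scalar vP)) radiusExpr)
        (.realLE (distExpr (scalar vJ) (scalar vQ)) radiusExpr))))

/-- Look for a pair of locations that serves the clients `vI` and `vJ`. -/
def witnessBlk : Blk :=
  .loop vP (.loop vQ (.ite servesTest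
    (.seq (.set mAdj (scalar vI) (scalar vJ) (const 1))
      (.seq (.set mFst (scalar vI) (scalar vJ) (scalar vP))
        (.set mSnd (scalar vI) (scalar vJ) (scalar vQ))))
    .skip))

/-- Compute which pairs of clients can be served by one pair of locations, and such a pair. -/
def adjBlk : Blk :=
  .loop vI (.loop vJ (.seq (.set mAdj (scalar vI) (scalar vJ) (const 0))
    witnessBlk))

/-- The test that `vQ` is a neighbour of `mCur` among the representatives of the second time step
and cheaper than the best one found before. -/
def cheaperTest : Test :=
  .and (.pos (.read mRep (const 1) (scalar vQ))) (.and (.pos (.read mAdj (scalar mCur) (scalar vQ)))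
    (.lt (.read mPrice (const 0) (scalar vQ)) (scalar mBestPrice)))

/-- Find a cheapest neighbour of `mCur` among the representatives of the second time step whose
price is at most `N`. If there is none, `mBestPrice` is `N + 1`. -/
def cheapestBlk : Blk :=
  .seq (.assign mBestPrice (.add (scalar mN) (const 1)))
    (.loop vQ (.ite cheaperTest
      (.seq (.assign mBestPrice (.read mPrice (const 0) (scalar vQ)))
        (.assign mBest (scalar vQ)))
      .skip))

/-- One bid of the auction: `mCur` takes over a cheapest neighbour, raises its price and is replaced
by the former owner; or it quits, if all its neighbours are too expensive. -/
def bidBlk : Blk :=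
  .ite (.lt (scalar mCur) (scalar mN))
    (.seq cheapestBlk (.ite (.natLE (scalar mBestPrice) (scalar mN))
      (.seq (.assign mTmp (.read mOwner (const 0) (scalar mBest)))
        (.seq (.set mOwner (const 0) (scalar mBest) (scalar mCur))
          (.seq (.set mPrice (const 0) (scalar mBest) (.add (scalar mBestPrice) (const 1)))
            (.assign mCur (scalar mTmp)))))
      (.seq (.set mQuit (const 0) (scalar mCur) (const 1)) (.assign mCur (scalar mN)))))
    .skip

/-- The initial state of the auction: all prices are zero and no vertex is owned. -/
def auctionInitBlk : Blk :=
  .loop vI (.seq (.set mPrice (const 0) (scalar vI) (const 0))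
    (.seq (.set mOwner (const 0) (scalar vI) (scalar mN))
      (.set mQuit (const 0) (scalar vI) (const 0))))

/-- Let the representatives of the first time step enter the auction one after the other. -/
def auctionBlk : Blk :=
  .loop vI (.ite (.pos (.read mRep (const 0) (scalar vI)))
    (.seq (.assign mCur (scalar vI)) (.loop vJ (.loop vP bidBlk))) .skip)

/-- Set `mBad` unless the vertices `e` and `f` can be served by one pair of locations. -/
def checkAdjBlk (e f : NatExpr) : Blk :=
  .ite (.pos (.read mAdj e f)) .skip (.assign mBad (const 1))

/-- Count the pairs of locations needed, and check that they exist. -/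
def checkBlk : Blk :=
  .seq (.assign mCount (const 0)) (.seq (.assign mBad (const 0)) (.seq
    (checkAdjBlk (scalar mN) (scalar mN))
    (.loop vI (.seq
      (.ite (.pos (.read mRep (const 1) (scalar vI)))
        (.seq (.assign mCount (.add (scalar mCount) (const 1)))
          (checkAdjBlk (.read mOwner (const 0) (scalar vI)) (scalar vI))) .skip)
      (.ite (.pos (.read mQuit (const 0) (scalar vI)))
        (.seq (.assign mCount (.add (scalar mCount) (const 1)))
          (checkAdjBlk (scalar vI) (scalar mN))) .skip)))))

/-- Add `m` copies of the pair of locations serving `e` and `f` to the output. -/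
def emitBlk (e f m : NatExpr) : Blk :=
  .seq (.set mOut (const 0) (.read mFst e f) (.add (.read mOut (const 0) (.read mFst e f)) m))
    (.set mOut (const 1) (.read mSnd e f) (.add (.read mOut (const 1) (.read mSnd e f)) m))

/-- Write the solution found to the output. -/
def writeBlk : Blk :=
  .seq (.loop vI (.seq (.set mOut (const 0) (scalar vI) (const 0))
    (.set mOut (const 1) (scalar vI) (const 0)))) (.seq
  (.loop vI (.seq
    (.ite (.pos (.read mRep (const 1) (scalar vI)))
      (emitBlk (.read mOwner (const 0) (scalar vI)) (scalar vI) (const 1)) .skip)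
    (.ite (.pos (.read mQuit (const 0) (scalar vI)))
      (emitBlk (scalar vI) (scalar mN) (const 1)) .skip)))
  (emitBlk (scalar mN) (scalar mN) (.sub (scalar mK) (scalar mCount))))

/-- The computation for one guess of the radius. -/
def guessBlk : Blk :=
  .seq (repsBlk 0) (.seq (repsBlk 1) (.seq adjBlk (.seq auctionInitBlk (.seq auctionBlk checkBlk))))

/-- The solution found for the current guess exists, and no solution for a smaller radius has been
found before. -/
def improvesTest : Test :=
  .and (.natLE (scalar mBad) (const 0)) (.and (.natLE (scalar mCount) (scalar mK))
    (.not (.and (.pos (scalar mFlag))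
      (.realLE (distExpr (scalar mRowOpt) (scalar mColOpt)) radiusExpr))))

/-- Record the current guess as the best one and write the solution found for it. -/
def recordBlk : Blk :=
  .seq (.assign mFlag (const 1)) (.seq (.assign mRowOpt (scalar vRow))
    (.seq (.assign mColOpt (scalar vCol)) writeBlk))

/-- The approximation algorithm: all distances are tried as the radius. -/
def supplierBlk : Blk :=
  .loop vRow (.loop vCol (.seq guessBlk (.ite improvesTest recordBlk .skip)))

theorem supplierBlk_wellFormed : supplierBlk.WellFormed := by
  simp [supplierBlk, guessBlk, repsBlk, closeBlk, adjBlk, witnessBlk, auctionInitBlk, auctionBlk,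
    bidBlk, cheapestBlk, checkBlk, checkAdjBlk, recordBlk, writeBlk, emitBlk, Blk.WellFormed,
    Blk.writes]

theorem supplierBlk_writes : ∀ a ∈ supplierBlk.writes, 4 ≤ a := by
  simp [supplierBlk, guessBlk, repsBlk, closeBlk, adjBlk, witnessBlk, auctionInitBlk, auctionBlk,
    bidBlk, cheapestBlk, checkBlk, checkAdjBlk, recordBlk, writeBlk, emitBlk, Blk.writes]

/-! ### Correctness of the parts of the program -/

theorem Blk.den_skip (s : State) : Blk.skip.den s = s := rfl

theorem Blk.den_set (a : ℕ) (i j e : NatExpr) (s : State) :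
    (Blk.set a i j e).den s = s.setNat a (i.eval s) (j.eval s) (e.eval s) := rfl

theorem Blk.den_seq (P Q : Blk) (s : State) : (Blk.seq P Q).den s = Q.den (P.den s) := rfl

theorem Blk.den_ite_pos {b : Test} {P Q : Blk} {s : State} (h : b.Holds s) :
    (Blk.ite b P Q).den s = P.den s := if_pos h

theorem Blk.den_ite_neg {b : Test} {P Q : Blk} {s : State} (h : ¬ b.Holds s) :
    (Blk.ite b P Q).den s = Q.den s := if_neg h

/-- The memory `s` contains the instance `T`. -/
structure Represents (s : State) (T : Table) : Prop where
  size : s.nat mN 0 0 = T.N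
  number : s.nat mK 0 0 = T.k
  client : ∀ t v, 0 < s.nat mClient t v ↔ T.C t v
  site : ∀ t v, 0 < s.nat mSite t v ↔ T.F t v
  dist : ∀ v w, s.real 0 v w = T.D v w
  bound : s.real 1 0 0 = T.B

theorem Represents.agrees {s t : State} {T : Table} {W : List ℕ} (h : Represents s T)
    (hag : Agrees W s t) (hW : ∀ a ∈ W, 4 ≤ a) : Represents t T := by
  have h' : ∀ a < 4, t.nat a = s.nat a := fun a ha => hag.nat a fun hm => by
    have := hW a hm
    omega
  constructor
  · rw [h' _ (by norm_num), h.size]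
  · rw [h' _ (by norm_num), h.number]
  · rw [h' _ (by norm_num)]; exact h.client
  · rw [h' _ (by norm_num)]; exact h.site
  · rw [hag.real]; exact h.dist
  · rw [hag.real]; exact h.bound

theorem Represents.setNat {s : State} {T : Table} (h : Represents s T) {a : ℕ} (ha : 4 ≤ a)
    (i j v : ℕ) : Represents (s.setNat a i j v) T :=
  h.agrees (agrees_setNat (W := [a]) (by simp) s i j v) (by simpa using ha)

/-- The radius currently tried. -/
abbrev radius (T : Table) (s : State) : ℝ := T.D (s.nat vRow 0 0) (s.nat vCol 0 0)

theorem radius_agrees {s t : State} {T : Table} {W : List ℕ} (hag : Agrees W s t)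
    (h : vRow ∉ W) (h' : vCol ∉ W) : radius T t = radius T s := by
  rw [radius, hag.nat _ h, hag.nat _ h']

/-- The marks of time step `t` form a net for the current radius. -/
theorem repsBlk_spec {s : State} {T : Table} (hs : Represents s T) (t : ℕ) :
    T.IsNet (radius T s) t (fun v => 0 < ((repsBlk t).den s).nat mRep t v) := by
  have key := Blk.den_loop_induction (L := repsBlk t) rfl hs.size
    (fun i st => ∀ v < i, (0 < st.nat mRep t v ↔
      T.C t v ∧ ∀ w < v, 0 < st.nat mRep t w → radius T s + radius T s < T.D v w))
    (by intro i st v h; simpa [State.setNat_nat] using h) (by simp) ?_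
  · exact fun v hv => key v (Nat.lt_succ_of_le hv)
  intro i hi st hag hx hinv
  have hst := hs.agrees hag (by simp [repsBlk, closeBlk, Blk.writes])
  have hrad := radius_agrees (T := T) hag (by simp [repsBlk, closeBlk, Blk.writes])
    (by simp [repsBlk, closeBlk, Blk.writes])
  simp only [Blk.den_seq, Blk.den_set]
  set s1 := st.setNat mTmp ((const 0).eval st) ((const 0).eval st)
    ((NatExpr.read mClient (const t) (scalar vI)).eval st) with hs1
  have hs1r : Represents s1 T := hst.setNat (by norm_num) _ _ _
  have h6 : s1.nat mRep = st.nat mRep := st.setNat_nat_of_ne _ _ _ (by norm_num)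
  have h1I : s1.nat vI 0 0 = i := by simp [hs1, State.setNat_nat, hx]
  have hrad1 : radius T s1 = radius T s := by rw [← hrad]; simp [radius, hs1, State.setNat_nat]
  have key2 := Blk.den_loop_induction (L := closeBlk t) rfl hs1r.size
    (fun j s2 => (0 < s2.nat mTmp 0 0 ↔ T.C t i ∧ ∀ w < j, w < i → 0 < st.nat mRep t w →
      radius T s + radius T s < T.D i w))
    (by intro j s2 v h; simpa [State.setNat_nat] using h)
    (by simp [hs1, State.setNat_nat, NatExpr.eval, hx, hst.client]) (by
    intro j hj s2 hag2 hx2 hinv2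
    have hs2 := hs1r.agrees hag2 (by simp [closeBlk, Blk.writes])
    have hr : T.D (s2.nat vRow 0 0) (s2.nat vCol 0 0) = radius T s := (radius_agrees (T := T) hag2
      (by simp [closeBlk, Blk.writes]) (by simp [closeBlk, Blk.writes])).trans hrad1
    have e6 := (hag2.nat mRep (by simp [closeBlk, Blk.writes])).trans h6
    have eI : s2.nat vI 0 0 = i := by rw [hag2.nat _ (by simp [closeBlk, Blk.writes]), h1I]
    have htest : (closeTest t).Holds s2 ↔
        j < i ∧ 0 < st.nat mRep t j ∧ T.D i j ≤ radius T s + radius T s := by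
      simp only [closeTest, Test.Holds, NatExpr.eval, RealExpr.eval, hx2, eI, e6, hs2.dist, hr,
        Nat.succ_le_iff]
    by_cases hb : j < i ∧ 0 < st.nat mRep t j ∧ T.D i j ≤ radius T s + radius T s
    · rw [Blk.den_ite_pos (htest.2 hb), Blk.den_set]
      simp only [NatExpr.eval, State.setNat_nat, and_self, if_true, lt_irrefl, false_iff, not_and,
        not_forall, not_lt]
      exact fun _ => ⟨j, by omega, hb.1, hb.2.1, hb.2.2⟩
    · rw [Blk.den_ite_neg (fun h => hb (htest.1 h)), Blk.den_skip, hinv2]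
      refine and_congr_right fun _ => ⟨fun h w hw hwi hSw => ?_, fun h w hw => h w (by omega)⟩
      rcases Nat.lt_succ_iff_lt_or_eq.1 hw with hw | rfl
      · exact h w hw hwi hSw
      · exact not_le.1 fun hle => hb ⟨hwi, hSw, hle⟩)
  have hag3 := (closeBlk t).agrees s1
  generalize (closeBlk t).den s1 = s3 at key2 hag3
  have e6 := (hag3.nat mRep (by simp [closeBlk, Blk.writes])).trans h6
  have eI : s3.nat vI 0 0 = i := by rw [hag3.nat _ (by simp [closeBlk, Blk.writes]), h1I]
  intro v hv
  simp only [NatExpr.eval, eI, State.setNat_nat, e6, true_and]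
  rcases Nat.lt_succ_iff_lt_or_eq.1 hv with hv | rfl
  · rw [if_neg (by omega), hinv v hv]
    refine and_congr_right fun _ => forall₂_congr fun w hw => ?_
    rw [if_neg (by omega)]
  · rw [if_pos rfl, key2]
    refine and_congr_right fun _ => ⟨fun h w hw => ?_, fun h w _ hw => ?_⟩
    · rw [if_neg (by omega)]
      exact h w (by omega) hw
    · have := h w hw
      rwa [if_neg (by omega)] at this

/-- The arrays `a`, `f`, `g` describe which clients can be served by one pair of locations: `a u v`
is positive if there is such a pair for `u` and `v`, and then `(f u v, g u v)` is one. -/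
structure IsWitness (T : Table) (r : ℝ) (a f g : ℕ → ℕ → ℕ) (u v : ℕ) : Prop where
  sound : 0 < a u v → T.Serves r u v (f u v) (g u v)
  complete : ∀ i ≤ T.N, ∀ j ≤ T.N, T.Serves r u v i j → 0 < a u v

theorem servesTest_holds {s : State} {T : Table} (hs : Represents s T) :
    servesTest.Holds s ↔ T.Serves (radius T s) (s.nat vI 0 0) (s.nat vJ 0 0) (s.nat vP 0 0)
      (s.nat vQ 0 0) := by
  simp only [servesTest, Test.Holds, NatExpr.eval, RealExpr.eval, hs.dist, hs.bound,
    Nat.succ_le_iff, hs.site, Table.Serves]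

/-- The search fills in the entries for the current pair of clients and no others. -/
theorem witnessBlk_spec {s : State} {T : Table} (hs : Represents s T)
    (h0 : s.nat mAdj (s.nat vI 0 0) (s.nat vJ 0 0) = 0) :
    let t := witnessBlk.den s
    IsWitness T (radius T s) (t.nat mAdj) (t.nat mFst) (t.nat mSnd) (s.nat vI 0 0) (s.nat vJ 0 0) ∧
      ∀ u v, (u = s.nat vI 0 0 ∧ v = s.nat vJ 0 0) ∨ (t.nat mAdj u v = s.nat mAdj u v ∧
        t.nat mFst u v = s.nat mFst u v ∧ t.nat mSnd u v = s.nat mSnd u v) := by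
  set u := s.nat vI 0 0 with hu
  set v := s.nat vJ 0 0 with hv
  have key := Blk.den_loop₂_induction (L := witnessBlk) rfl hs.size
    (by simp [witnessBlk, Blk.WellFormed, Blk.writes]) (by decide)
    (fun i j t => (0 < t.nat mAdj u v → T.Serves (radius T s) u v (t.nat mFst u v)
        (t.nat mSnd u v)) ∧
      (∀ i' ≤ T.N, ∀ j' ≤ T.N, i' < i ∨ i' = i ∧ j' < j → T.Serves (radius T s) u v i' j' →
        0 < t.nat mAdj u v) ∧
      ∀ u' v', (u' = u ∧ v' = v) ∨ (t.nat mAdj u' v' = s.nat mAdj u' v' ∧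
        t.nat mFst u' v' = s.nat mFst u' v' ∧ t.nat mSnd u' v' = s.nat mSnd u' v'))
    (by intro i j t v h; simpa [State.setNat_nat] using h)
    (by intro i j t v h; simpa [State.setNat_nat] using h)
    (by simp [h0]) ?_ ?_
  · exact ⟨⟨key.1, fun i hi j hj => key.2.1 i hi j hj (.inl (Nat.lt_succ_of_le hi))⟩, key.2.2⟩
  · rintro i hi t ⟨h1, h2, h3⟩
    exact ⟨h1, fun i' hi' j' hj' h => h2 i' hi' j' hj' (by omega), h3⟩
  · rintro i hi j hj t hag hti htj ⟨h1, h2, h3⟩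
    have ht := hs.agrees hag (by decide)
    have htest := servesTest_holds ht
    rw [radius_agrees hag (by decide) (by decide), hti, htj, hag.nat vI (by decide),
      hag.nat vJ (by decide), ← hu, ← hv] at htest
    have htu : t.nat vI 0 0 = u := by rw [hag.nat vI (by decide)]
    have htv : t.nat vJ 0 0 = v := by rw [hag.nat vJ (by decide)]
    by_cases hb : T.Serves (radius T s) u v i j
    · rw [Blk.den_ite_pos (htest.2 hb)]
      simp only [Blk.den_seq, Blk.den_set, NatExpr.eval, State.setNat_nat]
      norm_num [htu, htv, hti, htj]
      refine ⟨hb, fun u' v' => ?_⟩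
      rcases h3 u' v' with h | h
      · exact .inl h
      · by_cases h' : u' = u ∧ v' = v
        · exact .inl h'
        · simpa [h'] using h
    · rw [Blk.den_ite_neg (fun h => hb (htest.1 h)), Blk.den_skip]
      refine ⟨h1, fun i' hi' j' hj' h hS => ?_, h3⟩
      by_cases h' : i' = i ∧ j' = j
      · exact (hb (by rwa [← h'.1, ← h'.2])).elim
      · exact h2 i' hi' j' hj' (by omega) hS

theorem adjBlk_spec {s : State} {T : Table} (hs : Represents s T) :
    let t := adjBlk.den s
    ∀ u ≤ T.N, ∀ v ≤ T.N, IsWitness T (radius T s) (t.nat mAdj) (t.nat mFst) (t.nat mSnd) u v := by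
  have key := Blk.den_loop₂_induction (L := adjBlk) rfl hs.size
    (by simp [adjBlk, witnessBlk, Blk.WellFormed, Blk.writes]) (by decide)
    (fun i j t => ∀ u ≤ T.N, ∀ v ≤ T.N, u < i ∨ u = i ∧ v < j →
      IsWitness T (radius T s) (t.nat mAdj) (t.nat mFst) (t.nat mSnd) u v)
    (by intro i j t v h; simpa [State.setNat_nat_of_ne] using h)
    (by intro i j t v h; simpa [State.setNat_nat_of_ne] using h)
    (by simp) ?_ ?_
  · exact fun u hu v hv => key u hu v hv (.inl (Nat.lt_succ_of_le hu))
  · exact fun i hi t h u hu v hv h' => h u hu v hv (by omega)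
  · intro i hi j hj t hag hti htj hinv
    have ht := hs.agrees hag (by decide)
    rw [Blk.den_seq, Blk.den_set]
    simp only [NatExpr.eval, hti, htj]
    have ht1 : Represents (t.setNat mAdj i j 0) T := ht.setNat (by norm_num) _ _ _
    have h1i : (t.setNat mAdj i j 0).nat vI 0 0 = i := by
      rw [State.setNat_nat_of_ne _ _ _ _ (by norm_num), hti]
    have h1j : (t.setNat mAdj i j 0).nat vJ 0 0 = j := by
      rw [State.setNat_nat_of_ne _ _ _ _ (by norm_num), htj]
    have hw := witnessBlk_spec ht1 (by simp [h1i, h1j, State.setNat_nat])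
    have hr : radius T (t.setNat mAdj i j 0) = radius T s := by
      rw [← radius_agrees hag (by decide) (by decide)]
      simp [radius, State.setNat_nat]
    rw [h1i, h1j, hr] at hw
    generalize witnessBlk.den (t.setNat mAdj i j 0) = t' at hw
    intro u hu v hv huv
    by_cases h : u = i ∧ v = j
    · rw [h.1, h.2]
      exact hw.1
    · obtain ⟨e1, e2, e3⟩ := (hw.2 u v).resolve_left h
      have := hinv u hu v hv (by omega)
      simp only [State.setNat_nat, h, and_false, if_false] at e1
      rw [State.setNat_nat_of_ne _ _ _ _ (by norm_num)] at e2 e3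
      constructor
      · rw [e1, e2, e3]
        exact this.sound
      · rw [e1]
        exact this.complete

/-- The memory `s` contains a state of the auction with entered bidders `E`, for the graph
stored in the memory `s₀`. -/
def InAuction (T : Table) (s₀ : State) (E : ℕ → Prop) (s : State) : Prop :=
  Auction T.N (fun v => 0 < s₀.nat mRep 1 v) (fun u v => 0 < s₀.nat mAdj u v) E (s.nat mCur 0 0)
    (s.nat mPrice 0) (s.nat mOwner 0) (s.nat mQuit 0)

theorem cheapestBlk_spec {s : State} {T : Table} (hs : Represents s T) :
    let t := cheapestBlk.den s
    (t.nat mBestPrice 0 0 ≤ T.N → t.nat mBest 0 0 ≤ T.N ∧ 0 < s.nat mRep 1 (t.nat mBest 0 0) ∧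
      0 < s.nat mAdj (s.nat mCur 0 0) (t.nat mBest 0 0) ∧
      s.nat mPrice 0 (t.nat mBest 0 0) = t.nat mBestPrice 0 0) ∧
    ∀ w ≤ T.N, 0 < s.nat mRep 1 w → 0 < s.nat mAdj (s.nat mCur 0 0) w →
      t.nat mBestPrice 0 0 ≤ s.nat mPrice 0 w ∨ T.N < s.nat mPrice 0 w := by
  simp only [cheapestBlk, Blk.den_seq, Blk.den_set, NatExpr.eval, hs.size]
  set s1 := s.setNat mBestPrice 0 0 (T.N + 1) with hs1
  have hs1r : Represents s1 T := hs.setNat (by norm_num) _ _ _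
  have e : ∀ a, a ≠ mBestPrice → s1.nat a = s.nat a := fun a => s.setNat_nat_of_ne _ _ _
  have key := Blk.den_loop_induction (L := .loop vQ _) rfl hs1r.size
    (fun j t => (t.nat mBestPrice 0 0 ≤ T.N → t.nat mBest 0 0 ≤ T.N ∧
        0 < s.nat mRep 1 (t.nat mBest 0 0) ∧
        0 < s.nat mAdj (s.nat mCur 0 0) (t.nat mBest 0 0) ∧
        s.nat mPrice 0 (t.nat mBest 0 0) = t.nat mBestPrice 0 0) ∧
      ∀ w < j, 0 < s.nat mRep 1 w → 0 < s.nat mAdj (s.nat mCur 0 0) w →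
        t.nat mBestPrice 0 0 ≤ s.nat mPrice 0 w)
    (by intro i t v h; simpa [State.setNat_nat] using h)
    (by simp [hs1, State.setNat_nat])
    (P := .ite cheaperTest (.seq (.assign mBestPrice (.read mPrice (const 0) (scalar vQ)))
        (.assign mBest (scalar vQ))) .skip) ?_
  · exact ⟨key.1, fun w hw h h' => .inl (key.2 w (Nat.lt_succ_of_le hw) h h')⟩
  · rintro j hj t hag htj ⟨h1, h2⟩
    have e6 := (hag.nat mRep (by decide)).trans (e _ (by norm_num))
    have e7 := (hag.nat mAdj (by decide)).trans (e _ (by norm_num))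
    have e10 := (hag.nat mPrice (by decide)).trans (e _ (by norm_num))
    have e13 := (hag.nat mCur (by decide)).trans (e _ (by norm_num))
    have htest : cheaperTest.Holds t ↔ 0 < s.nat mRep 1 j ∧ 0 < s.nat mAdj (s.nat mCur 0 0) j ∧
        s.nat mPrice 0 j < t.nat mBestPrice 0 0 := by
      simp only [cheaperTest, Test.Holds, NatExpr.eval, htj, e6, e7, e10, e13, Nat.succ_le_iff]
    by_cases hb : 0 < s.nat mRep 1 j ∧ 0 < s.nat mAdj (s.nat mCur 0 0) j ∧
        s.nat mPrice 0 j < t.nat mBestPrice 0 0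
    · rw [Blk.den_ite_pos (htest.2 hb)]
      simp only [Blk.den_seq, Blk.den_set, NatExpr.eval, State.setNat_nat]
      norm_num [htj, e10]
      refine ⟨fun _ => ⟨hj, hb.1, hb.2.1⟩, fun w hw hR hA => ?_⟩
      rcases hw.lt_or_eq with hw | rfl
      · exact hb.2.2.le.trans (h2 w hw hR hA)
      · exact le_rfl
    · rw [Blk.den_ite_neg (fun h => hb (htest.1 h)), Blk.den_skip]
      refine ⟨h1, fun w hw hR hA => ?_⟩
      rcases Nat.lt_succ_iff_lt_or_eq.1 hw with hw | rfl
      · exact h2 w hw hR hA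
      · exact not_lt.1 fun h => hb ⟨hR, hA, h⟩

theorem setNat_row (s : State) (a i j v : ℕ) :
    (s.setNat a i j v).nat a i = Function.update (s.nat a i) j v := by
  funext j'
  by_cases h : j' = j
  · simp [State.setNat_nat, h]
  · simp [State.setNat_nat, h]

/-- A bid keeps the invariants; and it raises the sum of the
prices, unless it ends the turn. -/
theorem bidBlk_spec {s₀ s : State} {T : Table} (hs : Represents s T) {E : ℕ → Prop}
    (hR : ∀ v ≤ T.N, 0 < s₀.nat mRep 1 v → v < T.N) (h6 : s.nat mRep = s₀.nat mRep)
    (h7 : s.nat mAdj = s₀.nat mAdj) (h : InAuction T s₀ E s) :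
    let t := bidBlk.den s
    InAuction T s₀ E t ∧ (s.nat mCur 0 0 = T.N → t.nat mCur 0 0 = T.N) ∧
      (t.nat mCur 0 0 = T.N ∨
        ∑ v ∈ Finset.range T.N, t.nat mPrice 0 v =
          ∑ v ∈ Finset.range T.N, s.nat mPrice 0 v + 1) := by
  by_cases hcur : s.nat mCur 0 0 = T.N
  · rw [bidBlk, Blk.den_ite_neg (by simp [Test.Holds, NatExpr.eval, hcur, hs.size]), Blk.den_skip]
    exact ⟨h, fun _ => hcur, .inl hcur⟩
  have hlt : s.nat mCur 0 0 < T.N := h.entered_lt _ (h.cur_spec hcur).1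
  rw [bidBlk, Blk.den_ite_pos (by simpa [Test.Holds, NatExpr.eval, hs.size] using hlt),
    Blk.den_seq]
  have hc := cheapestBlk_spec hs
  have hag := cheapestBlk.agrees s
  generalize cheapestBlk.den s = s1 at hc hag
  have hs1 := hs.agrees hag (by decide)
  have h10 := hag.nat mPrice (by decide)
  have h11 := hag.nat mOwner (by decide)
  have h12 := hag.nat mQuit (by decide)
  have h13 := hag.nat mCur (by decide)
  rw [h6, h7] at hc
  by_cases hb : s1.nat mBestPrice 0 0 ≤ T.N
  · obtain ⟨hv, hRv, hAv, hp⟩ := hc.1 hb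
    have hvN := hR _ hv hRv
    have hbid := h.bid hcur hvN hRv hAv (hp.le.trans hb) (fun w hw hRw hAw => by
      rcases hc.2 w hw.le hRw hAw with h' | h' <;> omega)
    rw [Blk.den_ite_pos (by simpa [Test.Holds, NatExpr.eval, hs1.size] using hb)]
    simp only [Blk.den_seq, Blk.den_set, NatExpr.eval, InAuction]
    simp only [setNat_row, State.setNat_nat_of_ne, State.setNat_nat, h10, h11, h12, h13, ne_eq,
      Nat.reduceEqDiff, not_false_eq_true, false_and, and_self, if_false, if_true]
    rw [← hp]
    refine ⟨hbid, fun h => (hcur h).elim, .inr ?_⟩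
    simp only [true_and, ← Function.update_apply]
    rw [Finset.sum_update_of_mem (Finset.mem_range.2 hvN),
      ← Finset.add_sum_erase _ _ (Finset.mem_range.2 hvN), Finset.sdiff_singleton_eq_erase]
    omega
  · have hq := h.giveUp hcur (fun w hw hRw hAw => by
      rcases hc.2 w hw.le hRw hAw with h' | h' <;> omega)
    rw [Blk.den_ite_neg (by simpa [Test.Holds, NatExpr.eval, hs1.size] using hb)]
    simp only [Blk.den_seq, Blk.den_set, NatExpr.eval, InAuction]
    simp only [setNat_row, State.setNat_nat_of_ne, State.setNat_nat, h10, h11, h12, h13, ne_eq,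
      Nat.reduceEqDiff, not_false_eq_true, and_self, if_true, hs1.size]
    exact ⟨hq, by simp, by simp⟩

theorem auctionInitBlk_spec {s : State} {T : Table} (hs : Represents s T) :
    let t := auctionInitBlk.den s
    (∀ v ≤ T.N, t.nat mPrice 0 v = 0) ∧ (∀ v ≤ T.N, t.nat mOwner 0 v = T.N) ∧
      ∀ v ≤ T.N, t.nat mQuit 0 v = 0 := by
  have key := Blk.den_loop_induction (L := auctionInitBlk) rfl hs.size
    (fun i t => ∀ v < i, t.nat mPrice 0 v = 0 ∧ t.nat mOwner 0 v = T.N ∧ t.nat mQuit 0 v = 0)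
    (by intro i t v h; simpa [State.setNat_nat] using h)
    (by simp) ?_
  · exact ⟨fun v hv => (key v (Nat.lt_succ_of_le hv)).1,
      fun v hv => (key v (Nat.lt_succ_of_le hv)).2.1,
      fun v hv => (key v (Nat.lt_succ_of_le hv)).2.2⟩
  · intro i hi t hag hti hinv v hv
    have ht := hs.agrees hag (by decide)
    simp only [Blk.den_seq, Blk.den_set, NatExpr.eval, State.setNat_nat]
    norm_num [hti, ht.size]
    by_cases h : v = i
    · simp [h]
    · simpa [h] using hinv v (by omega)

/-- After all representatives of the first time step have entered, the auction is over. -/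
theorem auctionBlk_spec {s : State} {T : Table} (hs : Represents s T)
    (hL : ∀ v ≤ T.N, 0 < s.nat mRep 0 v → v < T.N) (hR : ∀ v ≤ T.N, 0 < s.nat mRep 1 v → v < T.N)
    (hp : ∀ v ≤ T.N, s.nat mPrice 0 v = 0) (ho : ∀ v ≤ T.N, s.nat mOwner 0 v = T.N)
    (hq : ∀ v ≤ T.N, s.nat mQuit 0 v = 0) :
    let t := auctionBlk.den s
    Auction T.N (fun v => 0 < s.nat mRep 1 v) (fun u v => 0 < s.nat mAdj u v)
      (fun u => u ≤ T.N ∧ 0 < s.nat mRep 0 u) T.N (t.nat mPrice 0) (t.nat mOwner 0)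
      (t.nat mQuit 0) := by
  have key := Blk.den_loop_induction (L := auctionBlk) rfl hs.size
    (fun i t => Auction T.N (fun v => 0 < s.nat mRep 1 v) (fun u v => 0 < s.nat mAdj u v)
      (fun u => u < i ∧ 0 < s.nat mRep 0 u) T.N (t.nat mPrice 0) (t.nat mOwner 0)
      (t.nat mQuit 0))
    (by intro i t v h; simpa [State.setNat_nat_of_ne] using h)
    ((Auction.init hp ho hq).congr_entered (by simp)) ?_
  · exact key.congr_entered fun u => by rw [Nat.lt_succ_iff]
  intro i hi t hag hti hinv
  have ht := hs.agrees hag (by decide)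
  have h6 := hag.nat mRep (by decide)
  have h7 := hag.nat mAdj (by decide)
  by_cases hb : 0 < s.nat mRep 0 i
  · rw [Blk.den_ite_pos (show 0 < _ by simpa [NatExpr.eval, h6, hti] using hb), Blk.den_seq,
      Blk.den_set]
    simp only [NatExpr.eval, hti]
    have hi' := hL i hi hb
    set s1 := t.setNat mCur 0 0 i with hs1
    have hs1r : Represents s1 T := ht.setNat (by norm_num) _ _ _
    have e : ∀ a, a ≠ mCur → s1.nat a = t.nat a := fun a => t.setNat_nat_of_ne _ _ _
    have hent := hinv.enter hi' (by simp)
    -- After `i` and `j` rounds of the two loops either the turn is over, or the sum of the prices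
    -- is at least `i * (N + 1) + j`; at the end this exceeds `N` times the maximal price `N + 1`.
    have key2 := Blk.den_loop₂_induction (L := .loop vJ (.loop vP bidBlk)) rfl hs1r.size
      (by simp [bidBlk, cheapestBlk, Blk.WellFormed, Blk.writes]) (by decide)
      (fun k l r => InAuction T s (fun u => (u < i ∧ 0 < s.nat mRep 0 u) ∨ u = i) r ∧
        (r.nat mCur 0 0 = T.N ∨
          k * (T.N + 1) + l ≤ ∑ v ∈ Finset.range T.N, r.nat mPrice 0 v))
      (by intro k l r v h; simpa [InAuction, State.setNat_nat_of_ne, State.setNat_nat] using h)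
      (by intro k l r v h; simpa [InAuction, State.setNat_nat_of_ne, State.setNat_nat] using h)
      (by simpa [InAuction, hs1, State.setNat_nat_of_ne, State.setNat_nat] using hent)
      (fun k _ r h => ⟨h.1, h.2.imp_right fun h' => by rw [Nat.succ_mul]; omega⟩) (by
      rintro k hk l hl r hagr - - ⟨h1, h2⟩
      have hr := hs1r.agrees hagr (by decide)
      obtain ⟨g1, g2, g3⟩ := bidBlk_spec (s₀ := s) hr hR
        ((hagr.nat mRep (by decide)).trans ((e _ (by norm_num)).trans h6))
        ((hagr.nat mAdj (by decide)).trans ((e _ (by norm_num)).trans h7)) h1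
      refine ⟨g1, ?_⟩
      rcases h2 with h2 | h2
      · exact .inl (g2 h2)
      · rcases g3 with g3 | g3
        · exact .inl g3
        · right; omega)
    generalize Blk.den _ s1 = r at key2
    obtain ⟨h1, h2⟩ := key2
    have hcur : r.nat mCur 0 0 = T.N := by
      refine h2.resolve_right fun h2 => ?_
      have h3 : ∑ v ∈ Finset.range T.N, r.nat mPrice 0 v ≤ T.N * (T.N + 1) := by
        simpa using Finset.sum_le_card_nsmul (Finset.range T.N) _ (T.N + 1)
          fun v hv => h1.price_le v (Finset.mem_range.1 hv)
      rw [Nat.succ_mul] at h2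
      omega
    rw [InAuction, hcur] at h1
    refine h1.congr_entered fun u => ?_
    constructor
    · rintro (h | rfl)
      · exact ⟨by omega, h.2⟩
      · exact ⟨by omega, hb⟩
    · rintro ⟨h, h'⟩
      rcases Nat.lt_succ_iff_lt_or_eq.1 h with h | h
      · exact .inl ⟨h, h'⟩
      · exact .inr h
  · rw [Blk.den_ite_neg (by simpa [Test.Holds, NatExpr.eval, h6, hti] using hb), Blk.den_skip]
    refine hinv.congr_entered fun u => ⟨fun h => ⟨by omega, h.2⟩, fun h => ⟨?_, h.2⟩⟩
    rcases Nat.lt_succ_iff_lt_or_eq.1 h.1 with h' | rfl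
    · exact h'
    · exact (hb h.2).elim

/-- The edges that cover all representatives: every representative `v < i` of the second time step
with its owner, and every bidder `v < i` that has quit with the dummy `N`. -/
def coverEdges (N : ℕ) (R own g : ℕ → ℕ) : ℕ → Multiset (ℕ × ℕ)
  | 0 => 0
  | i + 1 => coverEdges N R own g i + (if 0 < R i then {(own i, i)} else 0) +
      (if 0 < g i then {(i, N)} else 0)

section coverEdges

variable {N : ℕ} {R own g : ℕ → ℕ}

theorem mem_coverEdges {i : ℕ} {e : ℕ × ℕ} : e ∈ coverEdges N R own g i ↔
    ∃ v < i, 0 < R v ∧ e = (own v, v) ∨ 0 < g v ∧ e = (v, N) := by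
  induction i with
  | zero => simp [coverEdges]
  | succ i ih =>
    simp only [coverEdges, Multiset.mem_add, ih, Nat.exists_lt_succ_right, or_assoc]
    refine or_congr_right (or_congr ?_ ?_) <;> split_ifs with h <;> simp [h]

theorem card_coverEdges (i : ℕ) : (coverEdges N R own g i).card =
    ((Finset.range i).filter fun v => 0 < g v).card +
      ((Finset.range i).filter fun v => 0 < R v).card := by
  induction i with
  | zero => simp [coverEdges]
  | succ i ih =>
    rw [coverEdges, Multiset.card_add, Multiset.card_add, ih, Finset.range_add_one,
      Finset.filter_insert, Finset.filter_insert]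
    split_ifs <;> simp <;> omega

end coverEdges

/-- The edges read off from the memory. -/
abbrev stateEdges (N : ℕ) (s : State) (i : ℕ) : Multiset (ℕ × ℕ) :=
  coverEdges N (s.nat mRep 1) (s.nat mOwner 0) (s.nat mQuit 0) i

theorem stateEdges_congr {N : ℕ} {s t : State} (h6 : t.nat mRep = s.nat mRep)
    (h11 : t.nat mOwner = s.nat mOwner) (h12 : t.nat mQuit = s.nat mQuit) (i : ℕ) :
    stateEdges N t i = stateEdges N s i := by
  rw [stateEdges, h6, h11, h12]

theorem checkAdjBlk_den (e f : NatExpr) (s : State) : (checkAdjBlk e f).den s =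
    if 0 < s.nat mAdj (e.eval s) (f.eval s) then s else s.setNat mBad 0 0 1 := by
  split_ifs with h
  · rw [checkAdjBlk, Blk.den_ite_pos (b := .pos (.read mAdj e f)) (show 0 < _ from h), Blk.den_skip]
  · rw [checkAdjBlk, Blk.den_ite_neg (b := .pos (.read mAdj e f)) (show ¬ 0 < _ from h),
      Blk.den_set]
    simp only [NatExpr.eval]

/-- Invariant of the counting loop for the edges `M` counted so far. -/
def Counted (N : ℕ) (s₀ t : State) (M : Multiset (ℕ × ℕ)) : Prop :=
  t.nat mCount 0 0 = M.card ∧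
    (t.nat mBad 0 0 = 0 ↔ 0 < s₀.nat mAdj N N ∧ ∀ e ∈ M, 0 < s₀.nat mAdj e.1 e.2)

/-- The body of the counting loop counts the edge `(u, v)` if `p` holds. -/
theorem Counted.step {N : ℕ} {s₀ t : State} {M : Multiset (ℕ × ℕ)} (h : Counted N s₀ t M)
    {b : Test} {e f : NatExpr} (h7 : t.nat mAdj = s₀.nat mAdj) {u v : ℕ} {p : Prop} [Decidable p]
    (hb : b.Holds t ↔ p) (he : ∀ n, e.eval (t.setNat mCount 0 0 n) = u)
    (hf : ∀ n, f.eval (t.setNat mCount 0 0 n) = v) :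
    Counted N s₀ ((Blk.ite b (.seq (.assign mCount (.add (scalar mCount) (const 1)))
      (checkAdjBlk e f)) .skip).den t) (M + if p then {(u, v)} else 0) := by
  by_cases hp : p
  · rw [Blk.den_ite_pos (hb.2 hp), if_pos hp, Blk.den_seq, Blk.den_set, checkAdjBlk_den]
    simp only [NatExpr.eval, he, hf, State.setNat_nat_of_ne, h7, ne_eq, Nat.reduceEqDiff,
      not_false_eq_true]
    split_ifs with ha
    · refine ⟨by simp [State.setNat_nat, h.1], ?_⟩
      simp only [State.setNat_nat]
      norm_num [or_imp, forall_and, ha]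
      simpa using h.2
    · refine ⟨by simp [State.setNat_nat, h.1], ?_⟩
      simp only [State.setNat_nat]
      norm_num [or_imp, forall_and, ha]
  · rw [Blk.den_ite_neg (fun h' => hp (hb.1 h')), if_neg hp, Blk.den_skip, add_zero]
    exact h

theorem checkBlk_spec {s : State} {T : Table} (hs : Represents s T) :
    Counted T.N s (checkBlk.den s) (stateEdges T.N s (T.N + 1)) := by
  simp only [checkBlk, Blk.den_seq, Blk.den_set, NatExpr.eval]
  set s1 := (s.setNat mCount 0 0 0).setNat mBad 0 0 0 with hs1
  have hs1r : Represents s1 T := (hs.setNat (by norm_num) _ _ _).setNat (by norm_num) _ _ _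
  have hc1 : Counted T.N s ((checkAdjBlk (scalar mN) (scalar mN)).den s1) 0 := by
    rw [checkAdjBlk_den]
    simp only [NatExpr.eval, hs1r.size]
    have : s1.nat mAdj = s.nat mAdj := by
      rw [hs1, State.setNat_nat_of_ne _ _ _ _ (by norm_num),
        State.setNat_nat_of_ne _ _ _ _ (by norm_num)]
    rw [this]
    split_ifs with ha
    · simp [Counted, ha, hs1, State.setNat_nat]
    · simpa [Counted, hs1, State.setNat_nat] using ha
  have hag : Agrees [mBad, mCount] s ((checkAdjBlk (scalar mN) (scalar mN)).den s1) :=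
    ((agrees_setNat (by simp) _ _ _ _).trans (agrees_setNat (by simp) _ _ _ _)).trans
      (((checkAdjBlk (scalar mN) (scalar mN)).agrees s1).mono
        (by simp [checkAdjBlk, Blk.writes]))
  generalize (checkAdjBlk (scalar mN) (scalar mN)).den s1 = s2 at hc1 hag
  refine Blk.den_loop_induction (L := .loop vI _) rfl (hs.agrees hag (by simp)).size
    (fun i t => Counted T.N s t (stateEdges T.N s i))
    (by intro i t v h; simpa [Counted, State.setNat_nat] using h) hc1 ?_
  intro i hi t hag2 hti hinv
  have e : ∀ a, a ∉ [vI, mBad, mCount] → t.nat a = s.nat a := fun a ha =>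
    ((hag.mono (by simp)).trans (hag2.mono (W' := [vI, mBad, mCount])
      (by simp [checkAdjBlk, Blk.writes]))).nat a ha
  have ht : t.nat mN 0 0 = T.N := by rw [e _ (by simp), hs.size]
  have h6 := e mRep (by simp)
  have h7 := e mAdj (by simp)
  have h11 := e mOwner (by simp)
  have h12 := e mQuit (by simp)
  rw [Blk.den_seq]
  have c1 := hinv.step (b := .pos (.read mRep (const 1) (scalar vI)))
    (e := .read mOwner (const 0) (scalar vI)) (f := scalar vI) h7 (p := 0 < s.nat mRep 1 i)
    (u := s.nat mOwner 0 i) (v := i)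
    (by rw [← h6, ← hti]; rfl) (by simp [NatExpr.eval, State.setNat_nat, hti, h11])
    (by simp [NatExpr.eval, State.setNat_nat, hti])
  have hag3 := Blk.agrees (.ite (.pos (.read mRep (const 1) (scalar vI)))
    (.seq (.assign mCount (.add (scalar mCount) (const 1)))
      (checkAdjBlk (.read mOwner (const 0) (scalar vI)) (scalar vI))) .skip) t
  generalize Blk.den (.ite (.pos (.read mRep (const 1) (scalar vI))) _ _) t = t' at c1 hag3
  have e' : ∀ a, a ∉ [mBad, mCount] → t'.nat a = t.nat a := fun a ha =>
    (hag3.mono (W' := [mBad, mCount]) (by simp [checkAdjBlk, Blk.writes])).nat a ha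
  refine c1.step ((e' _ (by simp)).trans h7) ?_ ?_ ?_
  · rw [← h12, ← hti, ← e' mQuit (by simp), ← e' vI (by simp)]; rfl
  · simp [NatExpr.eval, State.setNat_nat, e' vI (by simp), hti]
  · simp [NatExpr.eval, State.setNat_nat, e' mN (by simp), ht]

/-- The output arrays describe the pairs in `Q`. -/
def IsOutput (N : ℕ) (s : State) (Q : Multiset (ℕ × ℕ)) : Prop :=
  ∀ v ≤ N, s.nat mOut 0 v = (Q.map Prod.fst).count v ∧ s.nat mOut 1 v = (Q.map Prod.snd).count v

/-- The expressions `e`, `f`, `m` are evaluated again after the first write, so their values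
must not depend on the output array. -/
theorem IsOutput.emit {N : ℕ} {s : State} {Q : Multiset (ℕ × ℕ)} (h : IsOutput N s Q)
    {e f m : NatExpr} {u v n : ℕ} (he : ∀ t, Agrees [mOut] s t → e.eval t = u)
    (hf : ∀ t, Agrees [mOut] s t → f.eval t = v) (hm : ∀ t, Agrees [mOut] s t → m.eval t = n) :
    IsOutput N ((emitBlk e f m).den s)
      (Q + Multiset.replicate n (s.nat mFst u v, s.nat mSnd u v)) := by
  have h0 := Agrees.refl [mOut] s
  have h1 : Agrees [mOut] s
      (s.setNat mOut 0 (s.nat mFst u v) (s.nat mOut 0 (s.nat mFst u v) + n)) :=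
    agrees_setNat (by simp) _ _ _ _
  simp only [emitBlk, Blk.den_seq, Blk.den_set, NatExpr.eval, he _ h0, hf _ h0, hm _ h0, he _ h1,
    hf _ h1, hm _ h1]
  intro w hw
  obtain ⟨h2, h3⟩ := h w hw
  simp only [State.setNat_nat, Multiset.map_add, Multiset.count_add, Multiset.map_replicate,
    Multiset.count_replicate, ← h2, ← h3]
  norm_num
  constructor
  · by_cases h' : w = s.nat mFst u v
    · simp [h']
    · simp [h', Ne.symm h']
  · by_cases h' : w = s.nat mSnd u v
    · simp [h']
    · simp [h', Ne.symm h']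

/-- The pair of locations stored for an edge. -/
abbrev stateWitness (s : State) (e : ℕ × ℕ) : ℕ × ℕ := (s.nat mFst e.1 e.2, s.nat mSnd e.1 e.2)

theorem writeBlk_spec {s : State} {T : Table} (hs : Represents s T) :
    IsOutput T.N (writeBlk.den s) ((stateEdges T.N s (T.N + 1)).map (stateWitness s) +
      Multiset.replicate (T.k - s.nat mCount 0 0) (stateWitness s (T.N, T.N))) := by
  simp only [writeBlk, Blk.den_seq]
  have h1 := Blk.den_loop_induction (L := .loop vI (.seq (.set mOut (const 0) (scalar vI) (const 0))
    (.set mOut (const 1) (scalar vI) (const 0)))) rfl hs.size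
    (fun i t => ∀ v < i, t.nat mOut 0 v = 0 ∧ t.nat mOut 1 v = 0)
    (by intro i t v h; simpa [State.setNat_nat] using h) (by simp) (by
      intro i hi t hag hti hinv v hv
      simp only [Blk.den_seq, Blk.den_set, NatExpr.eval, State.setNat_nat]
      norm_num [hti]
      by_cases h : v = i
      · simp [h]
      · simpa [h] using hinv v (by omega))
  have hag1 := Blk.agrees (.loop vI (.seq (.set mOut (const 0) (scalar vI) (const 0))
    (.set mOut (const 1) (scalar vI) (const 0)))) s
  generalize Blk.den (.loop vI (.seq (.set _ _ _ _) _)) s = s1 at h1 hag1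
  replace hag1 : Agrees [vI, mOut] s s1 := hag1.mono (by simp [Blk.writes])
  have hs1 := hs.agrees hag1 (by simp)
  have h2 := Blk.den_loop_induction (L := .loop vI (.seq
    (.ite (.pos (.read mRep (const 1) (scalar vI)))
      (emitBlk (.read mOwner (const 0) (scalar vI)) (scalar vI) (const 1)) .skip)
    (.ite (.pos (.read mQuit (const 0) (scalar vI)))
      (emitBlk (scalar vI) (scalar mN) (const 1)) .skip))) rfl hs1.size
    (fun i t => IsOutput T.N t ((stateEdges T.N s i).map (stateWitness s)))
    (by intro i t v h; simpa [IsOutput, State.setNat_nat] using h)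
    (by intro v hv; simpa [coverEdges] using h1 v (Nat.lt_succ_of_le hv)) (by
      intro i hi t hag hti hinv
      have hag2 : Agrees [vI, mOut] s t := hag1.trans (hag.mono (by simp [emitBlk, Blk.writes]))
      rw [Blk.den_seq]
      set t' := Blk.den (.ite (.pos (.read mRep (const 1) (scalar vI)))
        (emitBlk (.read mOwner (const 0) (scalar vI)) (scalar vI) (const 1)) .skip) t with ht'
      have hag3 : Agrees [mOut] t t' := (Blk.agrees _ t).mono (by simp [emitBlk, Blk.writes])
      have hag4 : Agrees [vI, mOut] s t' := hag2.trans (hag3.mono (by simp))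
      have hti' : t'.nat vI 0 0 = i := by rw [hag3.nat _ (by simp), hti]
      rw [stateEdges, coverEdges, Multiset.map_add, Multiset.map_add]
      have c1 : IsOutput T.N t' ((stateEdges T.N s i).map (stateWitness s) +
          (if 0 < s.nat mRep 1 i then {(s.nat mOwner 0 i, i)} else 0 : Multiset (ℕ × ℕ)).map
            (stateWitness s)) := by
        by_cases hp : 0 < s.nat mRep 1 i
        · rw [ht', Blk.den_ite_pos (show 0 < _ by
            simpa [NatExpr.eval, hti, hag2.nat mRep (by simp)] using hp), if_pos hp]
          simpa [Multiset.replicate_one, hag2.nat mFst (by simp), hag2.nat mSnd (by simp)] using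
            hinv.emit (e := .read mOwner (const 0) (scalar vI)) (f := scalar vI) (m := const 1)
              (u := s.nat mOwner 0 i) (v := i) (n := 1)
              (fun r hr => by simp [NatExpr.eval, hr.nat, hti, hag2.nat])
              (fun r hr => by simp [NatExpr.eval, hr.nat, hti])
              (fun r hr => by simp [NatExpr.eval])
        · rw [ht', Blk.den_ite_neg (show ¬ 0 < _ by
            simpa [NatExpr.eval, hti, hag2.nat mRep (by simp)] using hp), if_neg hp, Blk.den_skip]
          simpa using hinv
      by_cases hp : 0 < s.nat mQuit 0 i
      · rw [Blk.den_ite_pos (show 0 < _ by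
          simpa [NatExpr.eval, hti', hag4.nat mQuit (by simp)] using hp), if_pos hp]
        simpa [Multiset.replicate_one, hag4.nat mFst (by simp), hag4.nat mSnd (by simp)] using
          c1.emit (e := scalar vI) (f := scalar mN) (m := const 1)
            (u := i) (v := T.N) (n := 1)
            (fun r hr => by simp [NatExpr.eval, hr.nat, hti'])
            (fun r hr => by simp [NatExpr.eval, hr.nat, hag4.nat, hs.size])
            (fun r hr => by simp [NatExpr.eval])
      · rw [Blk.den_ite_neg (show ¬ 0 < _ by
          simpa [NatExpr.eval, hti', hag4.nat mQuit (by simp)] using hp), if_neg hp, Blk.den_skip]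
        simpa using c1)
  have hag2 := Blk.agrees (.loop vI (.seq
    (.ite (.pos (.read mRep (const 1) (scalar vI)))
      (emitBlk (.read mOwner (const 0) (scalar vI)) (scalar vI) (const 1)) .skip)
    (.ite (.pos (.read mQuit (const 0) (scalar vI)))
      (emitBlk (scalar vI) (scalar mN) (const 1)) .skip))) s1
  generalize Blk.den (.loop vI _) s1 = s2 at h2 hag2
  replace hag2 : Agrees [vI, mOut] s s2 := hag1.trans (hag2.mono (by simp [emitBlk, Blk.writes]))
  simpa [hag2.nat mFst (by simp), hag2.nat mSnd (by simp)] using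
    h2.emit (e := scalar mN) (f := scalar mN) (m := .sub (scalar mK) (scalar mCount))
      (u := T.N) (v := T.N) (n := T.k - s.nat mCount 0 0)
      (fun r hr => by simp [NatExpr.eval, hr.nat, hag2.nat, hs.size])
      (fun r hr => by simp [NatExpr.eval, hr.nat, hag2.nat, hs.size])
      (fun r hr => by simp [NatExpr.eval, hr.nat, hag2.nat, hs.number])

/-! ### Correctness of the algorithm on tables -/

/-- The memory after the computation for the guess `r` of the radius. -/
structure IsComputed (T : Table) (r : ℝ) (s : State) : Prop where
  net₀ : T.IsNet r 0 fun v => 0 < s.nat mRep 0 v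
  net₁ : T.IsNet r 1 fun v => 0 < s.nat mRep 1 v
  witness : ∀ u ≤ T.N, ∀ v ≤ T.N, IsWitness T r (s.nat mAdj) (s.nat mFst) (s.nat mSnd) u v
  auction : Auction T.N (fun v => 0 < s.nat mRep 1 v) (fun u v => 0 < s.nat mAdj u v)
    (fun u => u ≤ T.N ∧ 0 < s.nat mRep 0 u) T.N (s.nat mPrice 0) (s.nat mOwner 0) (s.nat mQuit 0)
  counted : Counted T.N s s (stateEdges T.N s (T.N + 1))

theorem guessBlk_spec {s : State} {T : Table} (hT : T.Metric) (hs : Represents s T) :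
    IsComputed T (radius T s) (guessBlk.den s) := by
  simp only [guessBlk, Blk.den_seq]
  have n0 := repsBlk_spec hs 0
  have a1 : Agrees [vI, vJ, mTmp, mRep] s ((repsBlk 0).den s) :=
    ((repsBlk 0).agrees s).mono (by simp [repsBlk, closeBlk, Blk.writes])
  -- The second net is stored in another row, so the first one stays.
  have f1 : ((repsBlk 1).den ((repsBlk 0).den s)).nat mRep 0 = ((repsBlk 0).den s).nat mRep 0 := by
    have key := Blk.den_loop_induction (L := repsBlk 1) (s := (repsBlk 0).den s) rfl
      (hs.agrees a1 (by simp)).size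
      (fun _ t => t.nat mRep 0 = ((repsBlk 0).den s).nat mRep 0)
      (by intro i t v h; simpa [State.setNat_nat_of_ne] using h) rfl (by
        intro i hi t hag hti hinv
        rw [← hinv]
        funext j
        rw [Blk.den_seq, Blk.den_seq, Blk.den_set, State.setNat_nat,
          if_neg (by simp [NatExpr.eval]), ((closeBlk 1).agrees _).nat mRep
            (by simp [closeBlk, Blk.writes]), Blk.den_set,
          State.setNat_nat_of_ne _ _ _ _ (by norm_num)])
    exact key
  generalize (repsBlk 0).den s = s1 at n0 a1 f1
  have n1 := repsBlk_spec (hs.agrees a1 (by simp)) 1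
  have a2 : Agrees [vI, vJ, mTmp, mRep] s1 ((repsBlk 1).den s1) :=
    ((repsBlk 1).agrees s1).mono (by simp [repsBlk, closeBlk, Blk.writes])
  rw [radius_agrees a1 (by simp) (by simp)] at n1
  rw [← f1] at n0
  replace a2 := a1.trans a2
  generalize (repsBlk 1).den s1 = s2 at n0 n1 a2
  have hs2 := hs.agrees a2 (by simp)
  have w3 := adjBlk_spec hs2
  rw [radius_agrees a2 (by simp) (by simp)] at w3
  have a3 := adjBlk.agrees s2
  have h6 := a3.nat mRep (by decide)
  generalize adjBlk.den s2 = s3 at w3 a3 h6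
  have hs3 := hs2.agrees a3 (by decide)
  rw [← h6] at n0 n1
  have i4 := auctionInitBlk_spec hs3
  have a4 := auctionInitBlk.agrees s3
  have h6 := a4.nat mRep (by decide)
  have h7 := a4.nat mAdj (by decide)
  have h8 := a4.nat mFst (by decide)
  have h9 := a4.nat mSnd (by decide)
  generalize auctionInitBlk.den s3 = s4 at i4 a4 h6 h7 h8 h9
  have hs4 := hs3.agrees a4 (by decide)
  rw [← h6] at n0 n1
  simp only [← h7, ← h8, ← h9] at w3
  have a5 := auctionBlk_spec hs4 (fun v hv h => n0.lt hT hv h) (fun v hv h => n1.lt hT hv h)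
    i4.1 i4.2.1 i4.2.2
  have a5' := auctionBlk.agrees s4
  have h6 := a5'.nat mRep (by decide)
  have h7 := a5'.nat mAdj (by decide)
  have h8 := a5'.nat mFst (by decide)
  have h9 := a5'.nat mSnd (by decide)
  generalize auctionBlk.den s4 = s5 at a5 a5' h6 h7 h8 h9
  have hs5 := hs4.agrees a5' (by decide)
  rw [← h6] at n0 n1
  simp only [← h7, ← h8, ← h9] at w3
  simp only [← h6, ← h7] at a5
  have c6 := checkBlk_spec hs5
  have a6 := checkBlk.agrees s5
  have h6 := a6.nat mRep (by decide)
  have h7 := a6.nat mAdj (by decide)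
  have h8 := a6.nat mFst (by decide)
  have h9 := a6.nat mSnd (by decide)
  have h10 := a6.nat mPrice (by decide)
  have h11 := a6.nat mOwner (by decide)
  have h12 := a6.nat mQuit (by decide)
  generalize checkBlk.den s5 = s6 at c6 a6 h6 h7 h8 h9 h10 h11 h12
  refine ⟨h6 ▸ n0, h6 ▸ n1, ?_, ?_, ?_⟩
  · rwa [h7, h8, h9]
  · rwa [h6, h7, h10, h11, h12]
  · rw [stateEdges_congr h6 h11 h12, Counted, h7]
    exact c6

/-- If there is a solution for the guessed radius, the computation finds that the edges of the
cover can be served and are not too many. -/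
theorem IsComputed.complete {T : Table} (hT : T.Metric) (hk : 0 < T.k) {r : ℝ} (hr : 0 ≤ r)
    {s : State} (h : IsComputed T r s) {Q : Multiset (ℕ × ℕ)} (hQ : T.IsSolution r Q) :
    s.nat mBad 0 0 = 0 ∧ s.nat mCount 0 0 ≤ T.k := by
  have hser : ∀ u ≤ T.N, ∀ v ≤ T.N, ∀ i j, T.Serves r u v i j → 0 < s.nat mAdj u v :=
    fun u hu v hv i j hS => (h.witness u hu v hv).complete i (hT.site_lt _ _ hS.1).le j
      (hT.site_lt _ _ hS.2.1).le hS
  constructor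
  · rw [h.counted.2]
    constructor
    · obtain ⟨q, hq⟩ := Multiset.card_pos_iff_exists_mem.1 (hQ.card ▸ hk)
      obtain ⟨h1, h2, h3⟩ := hQ.allowed q hq
      exact hser _ le_rfl _ le_rfl _ _
        ⟨h1, h2, h3, by rwa [hT.dummy], by rwa [hT.dummy]⟩
    · intro e he
      obtain ⟨v, hv, ⟨hR, rfl⟩ | ⟨hg, rfl⟩⟩ := mem_coverEdges.1 he
      · rw [Nat.lt_succ_iff] at hv
        have hvN := h.net₁.lt hT hv hR
        by_cases hown : s.nat mOwner 0 v = T.N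
        · obtain ⟨q, hq, hd⟩ := hQ.snd v (h.net₁.client hv hR)
          obtain ⟨h1, h2, h3⟩ := hQ.allowed q hq
          exact hser _ hown.le _ hv _ _ ⟨h1, h2, h3, by rwa [hown, hT.dummy], hd⟩
        · exact (h.auction.owner v hvN hown).2.2.1
      · rw [Nat.lt_succ_iff] at hv
        obtain ⟨q, hq, hd⟩ := hQ.fst v (h.net₀.client hv (h.auction.quit v hv hg).1.2)
        obtain ⟨h1, h2, h3⟩ := hQ.allowed q hq
        exact hser _ hv _ le_rfl _ _ ⟨h1, h2, h3, hd, by rwa [hT.dummy]⟩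
  · obtain ⟨Z, W, hZ, hW, hind, hcard⟩ := h.auction.exists_independent
    have hle := hQ.card_le hT h.net₀ h.net₁ hZ (fun w hw => ⟨(hW w hw).1.le, (hW w hw).2⟩)
      (fun u hu w hw i j hS => hind u hu w hw (hser u (hZ u hu).1 w (hW w hw).1.le i j hS))
    have hN : ¬ 0 < s.nat mRep 1 T.N := fun hR => lt_irrefl _ (h.net₁.lt hT le_rfl hR)
    rw [h.counted.1, card_coverEdges]
    rw [Finset.range_add_one (n := T.N), Finset.filter_insert (p := fun v => 0 < s.nat mRep 1 v),
      if_neg hN, ← Finset.range_add_one]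
    omega

/-- If the check succeeds, the pairs serving the edges of the cover, together with copies of an
arbitrary pair, form a solution for three times the guessed radius. -/
theorem IsComputed.sound {T : Table} (hT : T.Metric) {r : ℝ} (hr : 0 ≤ r) {s : State}
    (h : IsComputed T r s) (hbad : s.nat mBad 0 0 = 0) (hcount : s.nat mCount 0 0 ≤ T.k) :
    T.IsSolution (r + r + r) ((stateEdges T.N s (T.N + 1)).map (stateWitness s) +
      Multiset.replicate (T.k - s.nat mCount 0 0) (stateWitness s (T.N, T.N))) := by
  obtain ⟨hdummy, hedges⟩ := h.counted.2.1 hbad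
  have hle : ∀ e ∈ stateEdges T.N s (T.N + 1), e.1 ≤ T.N ∧ e.2 ≤ T.N := by
    intro e he
    obtain ⟨v, hv, ⟨hR, rfl⟩ | ⟨hg, rfl⟩⟩ := mem_coverEdges.1 he
    · rw [Nat.lt_succ_iff] at hv
      refine ⟨?_, hv⟩
      by_cases hown : s.nat mOwner 0 v = T.N
      · exact hown.le
      · exact (h.auction.owner v (h.net₁.lt hT hv hR) hown).2.1.1
    · exact ⟨Nat.lt_succ_iff.1 hv, le_rfl⟩
  have hserves : ∀ e ∈ stateEdges T.N s (T.N + 1),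
      T.Serves r e.1 e.2 (stateWitness s e).1 (stateWitness s e).2 := fun e he =>
    (h.witness _ (hle e he).1 _ (hle e he).2).sound (hedges e he)
  have htri : ∀ t S, T.IsNet r t S → ∀ π : ℕ × ℕ → ℕ, ∀ c, T.C t c → (∀ u < T.N, S u →
      ∃ e ∈ stateEdges T.N s (T.N + 1), T.D u (π (stateWitness s e)) ≤ r ∧
        π (stateWitness s e) < T.N) →
      ∃ q ∈ (stateEdges T.N s (T.N + 1)).map (stateWitness s) +
        Multiset.replicate (T.k - s.nat mCount 0 0) (stateWitness s (T.N, T.N)),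
        T.D c (π q) ≤ r + r + r := by
    intro t S hS π c hc hu
    obtain ⟨u, huN, hSu, hd⟩ := hS.cover hT hr hc
    obtain ⟨e, he, hi, hiN⟩ := hu u huN hSu
    exact ⟨_, Multiset.mem_add.2 (.inl (Multiset.mem_map_of_mem _ he)),
      (hT.triangle c (hT.client_lt t c hc) u huN _ hiN).trans (add_le_add hd hi)⟩
  constructor
  · rw [Multiset.card_add, Multiset.card_map, Multiset.card_replicate, ← h.counted.1]
    omega
  · intro q hq
    rcases Multiset.mem_add.1 hq with hq | hq
    · obtain ⟨e, he, rfl⟩ := Multiset.mem_map.1 hq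
      obtain ⟨h1, h2, h3, -⟩ := hserves e he
      exact ⟨h1, h2, h3⟩
    · rw [Multiset.eq_of_mem_replicate hq]
      obtain ⟨h1, h2, h3, -⟩ := (h.witness T.N le_rfl T.N le_rfl).sound hdummy
      exact ⟨h1, h2, h3⟩
  · refine fun c hc => htri 0 _ h.net₀ Prod.fst c hc fun u hu hS => ?_
    have : ∃ e ∈ stateEdges T.N s (T.N + 1), e.1 = u := by
      rcases h.auction.total u ⟨hu.le, hS⟩ with h' | h' | ⟨v, hv, hvu⟩
      · omega
      · exact ⟨_, mem_coverEdges.2 ⟨u, by omega, .inr ⟨h', rfl⟩⟩, rfl⟩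
      · exact ⟨_, mem_coverEdges.2 ⟨v, by omega, .inl
          ⟨(h.auction.owner v hv (by omega)).1, rfl⟩⟩, hvu⟩
    obtain ⟨e, he, rfl⟩ := this
    exact ⟨e, he, (hserves e he).2.2.2.1, hT.site_lt _ _ (hserves e he).1⟩
  · refine fun c hc => htri 1 _ h.net₁ Prod.snd c hc fun u hu hS => ?_
    have he : (s.nat mOwner 0 u, u) ∈ stateEdges T.N s (T.N + 1) :=
      mem_coverEdges.2 ⟨u, by omega, .inl ⟨hS, rfl⟩⟩
    exact ⟨_, he, (hserves _ he).2.2.2.2, hT.site_lt _ _ (hserves _ he).2.1⟩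

/-- Either the flag is not set, and no distance `D a b` with `p a b` admits a solution; or the flag
is set, and the output is a solution for three times a distance that does not exceed any distance
`D a b` with `p a b` that admits a solution. -/
def IsResult (T : Table) (p : ℕ → ℕ → Prop) (s : State) : Prop :=
  (s.nat mFlag 0 0 = 0 ∧ ∀ a ≤ T.N, ∀ b ≤ T.N, p a b → ∀ Q, ¬ T.IsSolution (T.D a b) Q) ∨
  (s.nat mFlag 0 0 = 1 ∧ ∃ r, r = T.D (s.nat mRowOpt 0 0) (s.nat mColOpt 0 0) ∧
    (∃ Q, IsOutput T.N s Q ∧ T.IsSolution (r + r + r) Q) ∧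
    ∀ a ≤ T.N, ∀ b ≤ T.N, p a b → ∀ Q, T.IsSolution (T.D a b) Q → r ≤ T.D a b)

theorem IsResult.congr {T : Table} {p : ℕ → ℕ → Prop} {s t : State} (h : IsResult T p s)
    (h4 : t.nat mFlag = s.nat mFlag) (h5 : t.nat mOut = s.nat mOut)
    (h18 : t.nat mRowOpt = s.nat mRowOpt) (h19 : t.nat mColOpt = s.nat mColOpt) :
    IsResult T p t := by
  simpa only [IsResult, IsOutput, h4, h5, h18, h19] using h

theorem IsResult.mono {T : Table} {p q : ℕ → ℕ → Prop} {s : State} (h : IsResult T p s)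
    (hpq : ∀ a ≤ T.N, ∀ b ≤ T.N, q a b → p a b) : IsResult T q s :=
  h.imp (fun h => ⟨h.1, fun a ha b hb hq => h.2 a ha b hb (hpq a ha b hb hq)⟩)
    fun ⟨h, r, hr, hQ, hle⟩ =>
      ⟨h, r, hr, hQ, fun a ha b hb hq => hle a ha b hb (hpq a ha b hb hq)⟩

/-- The main loop, with the result for the guesses tried so far as the invariant. -/
theorem supplierBlk_spec {s : State} {T : Table} (hT : T.Metric) (hk : 0 < T.k)
    (hs : Represents s T) (hflag : s.nat mFlag 0 0 = 0) :
    IsResult T (fun _ _ => True) (supplierBlk.den s) := by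
  have key := Blk.den_loop₂_induction (L := supplierBlk) rfl hs.size supplierBlk_wellFormed
    (fun h => by simpa using supplierBlk_writes 0 h)
    (fun i j t => IsResult T (fun a b => a < i ∨ a = i ∧ b < j) t)
    (fun i j t v h => h.congr (State.setNat_nat_of_ne _ _ _ _ (by norm_num))
      (State.setNat_nat_of_ne _ _ _ _ (by norm_num)) (State.setNat_nat_of_ne _ _ _ _ (by norm_num))
      (State.setNat_nat_of_ne _ _ _ _ (by norm_num)))
    (fun i j t v h => h.congr (State.setNat_nat_of_ne _ _ _ _ (by norm_num))
      (State.setNat_nat_of_ne _ _ _ _ (by norm_num)) (State.setNat_nat_of_ne _ _ _ _ (by norm_num))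
      (State.setNat_nat_of_ne _ _ _ _ (by norm_num)))
    (.inl ⟨hflag, by omega⟩)
    (fun i hi t h => h.mono fun a _ b hb h' => by omega) ?_
  · exact key.mono fun a ha b _ _ => .inl (Nat.lt_succ_of_le ha)
  intro i hi j hj t hag hti htj hinv
  have ht := hs.agrees hag supplierBlk_writes
  have hrad : radius T t = T.D i j := by rw [radius, hti, htj]
  have hc := guessBlk_spec hT ht
  rw [hrad] at hc
  rw [Blk.den_seq]
  have ha := guessBlk.agrees t
  have ht1 := ht.agrees ha (by decide)
  have hinv1 := hinv.congr (ha.nat mFlag (by decide)) (ha.nat mOut (by decide))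
    (ha.nat mRowOpt (by decide)) (ha.nat mColOpt (by decide))
  have h20 := (congrFun₂ (ha.nat vRow (by decide)) 0 0).trans hti
  have h21 := (congrFun₂ (ha.nat vCol (by decide)) 0 0).trans htj
  generalize guessBlk.den t = t1 at hc ha ht1 hinv1 h20 h21
  have hr := hT.nonneg i j
  have htest : improvesTest.Holds t1 ↔ t1.nat mBad 0 0 = 0 ∧ t1.nat mCount 0 0 ≤ T.k ∧
      ¬ (0 < t1.nat mFlag 0 0 ∧
        T.D (t1.nat mRowOpt 0 0) (t1.nat mColOpt 0 0) ≤ T.D i j) := by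
    simp only [improvesTest, Test.Holds, NatExpr.eval, RealExpr.eval, ht1.number, ht1.dist, h20,
      h21, Nat.le_zero, Nat.succ_le_iff]
  by_cases hb : improvesTest.Holds t1
  · rw [Blk.den_ite_pos hb]
    obtain ⟨h1, h2, h3⟩ := htest.1 hb
    simp only [recordBlk, Blk.den_seq, Blk.den_set, NatExpr.eval]
    set t2 := ((t1.setNat mFlag 0 0 1).setNat mRowOpt 0 0 i).setNat mColOpt 0 0 j with ht2
    have he : (((t1.setNat mFlag 0 0 1).setNat mRowOpt 0 0
        ((t1.setNat mFlag 0 0 1).nat vRow 0 0)).setNat mColOpt 0 0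
          (((t1.setNat mFlag 0 0 1).setNat mRowOpt 0 0
            ((t1.setNat mFlag 0 0 1).nat vRow 0 0)).nat vCol 0 0)) = t2 := by
      simp [ht2, State.setNat_nat_of_ne, h20, h21]
    rw [he]
    have ht2r : Represents t2 T :=
      ((ht1.setNat (by norm_num) _ _ _).setNat (by norm_num) _ _ _).setNat (by norm_num) _ _ _
    have hw := writeBlk_spec ht2r
    have hwag := writeBlk.agrees t2
    have hag2 : Agrees [mFlag, mRowOpt, mColOpt] t1 t2 :=
      ((agrees_setNat (by simp) _ _ _ _).trans (agrees_setNat (by simp) _ _ _ _)).trans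
        (agrees_setNat (by simp) _ _ _ _)
    have hsound := hc.sound hT hr h1 h2
    simp only [stateWitness] at hsound hw
    rw [stateEdges_congr (hag2.nat mRep (by simp)) (hag2.nat mOwner (by simp))
      (hag2.nat mQuit (by simp)), hag2.nat mFst (by simp), hag2.nat mSnd (by simp),
      hag2.nat mCount (by simp)] at hw
    have g4 := hwag.nat mFlag (by decide)
    have g18 := hwag.nat mRowOpt (by decide)
    have g19 := hwag.nat mColOpt (by decide)
    generalize writeBlk.den t2 = t3 at hw g4 g18 g19
    refine .inr ⟨by simp [g4, ht2, State.setNat_nat], T.D i j, by simp [g18, g19, ht2,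
      State.setNat_nat], ⟨_, hw, hsound⟩, fun a ha b hb hab Q hQ => ?_⟩
    by_cases hij : a = i ∧ b = j
    · rw [hij.1, hij.2]
    · rcases hinv1 with ⟨-, hno⟩ | ⟨hf, r, hr', -, hle⟩
      · exact (hno a ha b hb (by omega) Q hQ).elim
      · have h4 : T.D i j < r := not_le.1 fun h => h3 ⟨by omega, hr' ▸ h⟩
        exact h4.le.trans (hle a ha b hb (by omega) Q hQ)
  · rw [Blk.den_ite_neg hb, Blk.den_skip]
    rcases hinv1 with ⟨hf, hno⟩ | ⟨hf, r, hr', hQ, hle⟩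
    · refine .inl ⟨hf, fun a ha b hb' hab Q hQ => ?_⟩
      by_cases hij : a = i ∧ b = j
      · rw [hij.1, hij.2] at hQ
        obtain ⟨h1, h2⟩ := hc.complete hT hk hr hQ
        exact hb (htest.2 ⟨h1, h2, fun h => by omega⟩)
      · exact hno a ha b hb' (by omega) Q hQ
    · refine .inr ⟨hf, r, hr', hQ, fun a ha b hb' hab Q hQ => ?_⟩
      by_cases hij : a = i ∧ b = j
      · rw [hij.1, hij.2] at hQ ⊢
        obtain ⟨h1, h2⟩ := hc.complete hT hk hr hQ
        by_contra h
        exact hb (htest.2 ⟨h1, h2, fun h' => h (hr' ▸ h'.2)⟩)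
      · exact hle a ha b hb' (by omega) Q hQ

end RAM

/-! ### From metric spaces to tables -/

namespace DynamicKSupplier

open RAM

variable {X : Type*} [MetricSpace X] (I : DynamicKSupplier X 2) {N : ℕ} (p : Fin N ↪ X)

open Classical in
/-- The instance `I` with the points numbered by `p`, as a table. -/
noncomputable def table : Table where
  N := N
  k := I.k
  C i j := ∃ (t : Fin 2) (v : Fin N), (t : ℕ) = i ∧ (v : ℕ) = j ∧ p v ∈ I.C t
  F i j := ∃ (t : Fin 2) (v : Fin N), (t : ℕ) = i ∧ (v : ℕ) = j ∧ p v ∈ I.F t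
  D i j := if h : i < N ∧ j < N then dist (p ⟨i, h.1⟩) (p ⟨j, h.2⟩) else 0
  B := I.B

theorem input_represents : Represents (I.input p) (I.table p) where
  size := by simp [input, table]
  number := by simp [input, table]
  client t v := by
    simp only [input, table]
    split_ifs with h <;> simpa using h
  site t v := by
    simp only [input, table]
    split_ifs with h <;> simpa using h
  dist v w := rfl
  bound := by simp [input, table]

variable {p}

theorem table_client {t : Fin 2} {v : Fin N} : (I.table p).C t v ↔ p v ∈ I.C t := by
  constructor
  · rintro ⟨t', v', ht, hv, h⟩
    rwa [← Fin.ext ht, ← Fin.ext hv]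
  · exact fun h => ⟨t, v, rfl, rfl, h⟩

theorem table_site {t : Fin 2} {v : Fin N} : (I.table p).F t v ↔ p v ∈ I.F t := by
  constructor
  · rintro ⟨t', v', ht, hv, h⟩
    rwa [← Fin.ext ht, ← Fin.ext hv]
  · exact fun h => ⟨t, v, rfl, rfl, h⟩

theorem table_dist (v w : Fin N) : (I.table p).D v w = dist (p v) (p w) := by
  simp [table]

theorem table_metric : (I.table p).Metric where
  client_lt t v := by
    rintro ⟨-, w, -, rfl, -⟩
    exact w.2
  site_lt t v := by
    rintro ⟨-, w, -, rfl, -⟩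
    exact w.2
  self v := by simp [table]
  symm v w := by
    simp only [table]
    by_cases h : v < N ∧ w < N
    · rw [dif_pos h, dif_pos h.symm, dist_comm]
    · rw [dif_neg h, dif_neg fun h' => h h'.symm]
  triangle u hu v hv w hw := by
    simpa only [← I.table_dist] using dist_triangle (p ⟨u, hu⟩) (p ⟨v, hv⟩) (p ⟨w, hw⟩)
  nonneg v w := by
    simp only [table]
    split_ifs
    · exact dist_nonneg
    · exact le_rfl
  dummy v := by simp [table]

/-- The clients of every time step are within distance `r` of the locations in `A`. -/
def Covers (A : Fin 2 → Multiset X) (r : ℝ) : Prop :=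
  ∀ t, ∀ j ∈ I.C t, ∃ i ∈ A t, dist j i ≤ r

variable {I}

theorem Covers.cost_le {A : Fin 2 → Multiset X} {r : ℝ} (h : I.Covers A r) :
    I.cost A ≤ ENNReal.ofReal r := by
  refine iSup_le fun t => iSup₂_le fun j hj => ?_
  obtain ⟨i, hi, hd⟩ := h t j hj
  refine (iInf₂_le i hi).trans ?_
  rw [edist_dist]
  exact ENNReal.ofReal_le_ofReal hd

theorem isFeasible_iff {A : Fin 2 → Multiset X} : I.IsFeasible A ↔ (∀ t, ∀ x ∈ A t, x ∈ I.F t) ∧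
    (∀ t, (A t).card = I.k) ∧ Multiset.Rel (fun x y => dist x y ≤ I.B) (A 0) (A 1) := by
  refine and_congr_right fun _ => and_congr_right fun _ => ⟨fun h => h 0 1 rfl, fun h t t' ht => ?_⟩
  obtain rfl : t = 0 := by omega
  obtain rfl : t' = 1 := by
    apply Fin.ext
    simpa using ht.symm
  exact h

/-- Matched multisets are the projections of a multiset of pairs. -/
theorem exists_pairs {α β : Type*} {r : α → β → Prop} {s : Multiset α} {t : Multiset β}
    (h : Multiset.Rel r s t) :
    ∃ Q : Multiset (α × β), Q.map Prod.fst = s ∧ Q.map Prod.snd = t ∧ ∀ q ∈ Q, r q.1 q.2 := by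
  induction h with
  | zero => exact ⟨0, by simp⟩
  | @cons a b as bs hab _ ih =>
    obtain ⟨Q, rfl, rfl, h⟩ := ih
    exact ⟨(a, b) ::ₘ Q, by simp, by simp, by simpa [hab] using h⟩

/-- A multiset all of whose elements are values of `f` is an image under `f`. -/
theorem exists_map_eq {α β : Type*} {f : α → β} {s : Multiset β} (h : ∀ x ∈ s, ∃ a, f a = x) :
    ∃ t : Multiset α, t.map f = s := by
  induction s using Multiset.induction_on with
  | empty => exact ⟨0, by simp⟩
  | cons b s ih =>
    obtain ⟨t, rfl⟩ := ih fun x hx => h x (Multiset.mem_cons_of_mem hx)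
    obtain ⟨a, rfl⟩ := h b (Multiset.mem_cons_self _ _)
    exact ⟨a ::ₘ t, by simp⟩

/-- The multiset described by a table of multiplicities. -/
theorem sum_replicate_count {α : Type*} (f : Fin N → α) (M : Multiset (Fin N)) :
    ∑ v : Fin N, Multiset.replicate (M.count v) (f v) = M.map f := by
  induction M using Multiset.induction_on with
  | empty => simp
  | cons a M ih =>
    simp only [Multiset.count_cons, Multiset.replicate_add, Finset.sum_add_distrib, ih,
      Multiset.map_cons]
    rw [Finset.sum_eq_single a (by intro b _ hb; simp [hb]) (by simp)]
    simp [add_comm (M.map f), Multiset.singleton_add]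

/-- A feasible solution whose locations cover the clients within `r` is a solution for the table. -/
theorem exists_isSolution (hp : I.Enumerates p) {A : Fin 2 → Multiset X} (hA : I.IsFeasible A)
    {r : ℝ} (hr : I.Covers A r) : ∃ Q, (I.table p).IsSolution r Q := by
  obtain ⟨hF, hcard, hrel⟩ := isFeasible_iff.1 hA
  obtain ⟨P, h0, h1, hP⟩ := exists_pairs hrel
  have hloc : ∀ t, ∀ x ∈ A t, ∃ v, p v = x := fun t x hx => (hp x).2 ⟨t, .inr (hF t x hx)⟩
  obtain ⟨Q, rfl⟩ : ∃ Q : Multiset (Fin N × Fin N), Q.map (Prod.map p p) = P := by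
    refine exists_map_eq fun x hx => ?_
    obtain ⟨v, hv⟩ := hloc 0 x.1 (h0 ▸ Multiset.mem_map_of_mem _ hx)
    obtain ⟨w, hw⟩ := hloc 1 x.2 (h1 ▸ Multiset.mem_map_of_mem _ hx)
    exact ⟨(v, w), Prod.ext hv hw⟩
  rw [Multiset.map_map] at h0 h1
  have hcov : ∀ t (π : Fin N × Fin N → Fin N) (π' : ℕ × ℕ → ℕ), (Q.map fun q => p (π q)) = A t →
      (∀ q : Fin N × Fin N, π' (q.1, q.2) = π q) → ∀ c, (I.table p).C (t : Fin 2) c →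
      ∃ q ∈ Q.map fun q => ((q.1 : ℕ), (q.2 : ℕ)), (I.table p).D c (π' q) ≤ r := by
    rintro t π π' hQ hπ c hc
    lift c to Fin N using I.table_metric.client_lt _ _ hc
    obtain ⟨i, hi, hd⟩ := hr t (p c) ((I.table_client).1 hc)
    rw [← hQ] at hi
    obtain ⟨q, hq, rfl⟩ := Multiset.mem_map.1 hi
    exact ⟨_, Multiset.mem_map_of_mem _ hq, by rwa [hπ, table_dist]⟩
  refine ⟨Q.map fun q => ((q.1 : ℕ), (q.2 : ℕ)), ?_, ?_, ?_, ?_⟩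
  · rw [Multiset.card_map, ← Multiset.card_map (f := Prod.fst ∘ Prod.map p p), h0, hcard]
    rfl
  · intro q hq
    obtain ⟨q', hq', rfl⟩ := Multiset.mem_map.1 hq
    refine ⟨(I.table_site (t := 0)).2 (hF 0 _ (h0 ▸ Multiset.mem_map_of_mem _ hq')),
      (I.table_site (t := 1)).2 (hF 1 _ (h1 ▸ Multiset.mem_map_of_mem _ hq')), ?_⟩
    rw [table_dist]
    exact hP _ (Multiset.mem_map_of_mem _ hq')
  · exact hcov 0 Prod.fst Prod.fst h0 fun _ => rfl
  · exact hcov 1 Prod.snd Prod.snd h1 fun _ => rfl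

/-- The cost of a feasible solution is bounded below by a distance for which the solution
covers all clients, namely by the largest distance not exceeding the cost. -/
theorem exists_covers (hp : I.Enumerates p) {A : Fin 2 → Multiset X} (hA : I.IsFeasible A) :
    ∃ a ≤ N, ∃ b ≤ N, I.Covers A ((I.table p).D a b) ∧
      ENNReal.ofReal ((I.table p).D a b) ≤ I.cost A := by
  classical
  set G := (Finset.range (N + 1) ×ˢ Finset.range (N + 1)).filter
    fun e => ENNReal.ofReal ((I.table p).D e.1 e.2) ≤ I.cost A
  -- The index `N` supplies the distance `0`.
  have hG : G.Nonempty := ⟨(N, N), by simp [G, table]⟩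
  obtain ⟨⟨a, b⟩, hab, hmax⟩ := G.exists_max_image (fun e => (I.table p).D e.1 e.2) hG
  simp only [G, Finset.mem_filter, Finset.mem_product, Finset.mem_range] at hab
  refine ⟨a, by omega, b, by omega, fun t j hj => ?_, hab.2⟩
  have hne : (A t).toFinset.Nonempty := by
    obtain ⟨x, hx⟩ := Multiset.card_pos_iff_exists_mem.1 (hA.2.1 t ▸ I.k_pos)
    exact ⟨x, Multiset.mem_toFinset.2 hx⟩
  obtain ⟨i, hi, hmin⟩ := (A t).toFinset.exists_min_image (edist j) hne
  rw [Multiset.mem_toFinset] at hi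
  obtain ⟨v, rfl⟩ := (hp j).2 ⟨t, .inl hj⟩
  obtain ⟨w, rfl⟩ := (hp i).2 ⟨t, .inr (hA.1 t i hi)⟩
  refine ⟨p w, hi, ?_⟩
  rw [← I.table_dist]
  refine hmax (v, w) ?_
  simp only [G, Finset.mem_filter, Finset.mem_product, Finset.mem_range]
  refine ⟨⟨by omega, by omega⟩, ?_⟩
  rw [table_dist, ← edist_dist]
  refine le_trans ?_ (le_iSup_of_le t (le_iSup₂_of_le (p v) hj le_rfl))
  exact le_iInf₂ fun i' hi' => hmin i' (Multiset.mem_toFinset.2 hi')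

/-- An output that describes a solution for the table is feasible and covers the clients. -/
theorem output_spec (hp : I.Enumerates p) {s : State} {Q : Multiset (ℕ × ℕ)} {r : ℝ}
    (hs : IsOutput N s Q) (hQ : (I.table p).IsSolution r Q) :
    I.IsFeasible (output p s) ∧ I.Covers (output p s) r := by
  obtain ⟨Q, rfl⟩ : ∃ Q' : Multiset (Fin N × Fin N), Q'.map (fun q => ((q.1 : ℕ), (q.2 : ℕ))) = Q :=
    exists_map_eq fun q hq =>
      ⟨(⟨q.1, I.table_metric.site_lt _ _ (hQ.allowed q hq).1⟩,
        ⟨q.2, I.table_metric.site_lt _ _ (hQ.allowed q hq).2.1⟩), rfl⟩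
  have h0 : output p s (0 : Fin 2) = (Q.map Prod.fst).map p := by
    rw [← sum_replicate_count]
    refine Finset.sum_congr rfl fun v _ => ?_
    rw [← Multiset.count_map_eq_count' _ _ Fin.val_injective, Multiset.map_map]
    exact congrArg₂ _ ((hs v v.2.le).1.trans (by rw [Multiset.map_map]; rfl)) rfl
  have h1 : output p s (1 : Fin 2) = (Q.map Prod.snd).map p := by
    rw [← sum_replicate_count]
    refine Finset.sum_congr rfl fun v _ => ?_
    rw [← Multiset.count_map_eq_count' _ _ Fin.val_injective, Multiset.map_map]
    exact congrArg₂ _ ((hs v v.2.le).2.trans (by rw [Multiset.map_map]; rfl)) rfl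
  rw [Multiset.map_map] at h0 h1
  have hcard : Q.card = I.k := (Multiset.card_map _ Q).symm.trans hQ.card
  have hall : ∀ q ∈ Q, p q.1 ∈ I.F 0 ∧ p q.2 ∈ I.F 1 ∧ dist (p q.1) (p q.2) ≤ I.B := by
    intro q hq
    obtain ⟨g1, g2, g3⟩ := hQ.allowed _ (Multiset.mem_map_of_mem _ hq)
    exact ⟨(I.table_site (t := 0)).1 g1, (I.table_site (t := 1)).1 g2, by rwa [table_dist] at g3⟩
  refine ⟨isFeasible_iff.2 ⟨Fin.forall_fin_two.2 ⟨?_, ?_⟩, Fin.forall_fin_two.2 ⟨?_, ?_⟩, ?_⟩,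
    Fin.forall_fin_two.2 ⟨?_, ?_⟩⟩
  · simp only [h0, Multiset.mem_map]
    rintro _ ⟨q, hq, rfl⟩
    exact (hall q hq).1
  · simp only [h1, Multiset.mem_map]
    rintro _ ⟨q, hq, rfl⟩
    exact (hall q hq).2.1
  · rw [h0, Multiset.card_map, hcard]
  · rw [h1, Multiset.card_map, hcard]
  · rw [h0, h1, Multiset.rel_map]
    exact Multiset.rel_refl_of_refl_on fun q hq => (hall q hq).2.2
  · intro j hj
    obtain ⟨c, rfl⟩ := (hp j).2 ⟨0, .inl hj⟩
    obtain ⟨_, hq, hd⟩ := hQ.fst c ((I.table_client (t := 0)).2 hj)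
    obtain ⟨q, hq', rfl⟩ := Multiset.mem_map.1 hq
    exact ⟨p q.1, h0 ▸ Multiset.mem_map_of_mem _ hq', by rwa [table_dist] at hd⟩
  · intro j hj
    obtain ⟨c, rfl⟩ := (hp j).2 ⟨1, .inl hj⟩
    obtain ⟨_, hq, hd⟩ := hQ.snd c ((I.table_client (t := 1)).2 hj)
    obtain ⟨q, hq', rfl⟩ := Multiset.mem_map.1 hq
    exact ⟨p q.2, h1 ▸ Multiset.mem_map_of_mem _ hq', by rwa [table_dist] at hd⟩

end DynamicKSupplier

open DynamicKSupplier RAM in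
/-- There is a polynomial-time 3-approximation algorithm for Dynamic `k`-Supplier with two time
steps. -/
theorem mainTheorem2 :
    ∃ P : RAM.Prog, DynamicKSupplier.IsPolyTimeApprox.{u} 2 3 P := by
  refine ⟨supplierBlk.compile, supplierBlk.time, ?_⟩
  intro X _ I N p hp
  have hrep := I.input_represents p
  have hsize : (I.input p).nat 0 0 0 = N := hrep.size
  obtain ⟨c, hexec, hc⟩ := Blk.exec_compile supplierBlk_wellFormed
    (fun h => by simpa using supplierBlk_writes 0 h) (M := N + Nat.size I.k) (I.input p)
    (by omega)
  have hres := supplierBlk_spec I.table_metric I.k_pos hrep rfl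
  generalize supplierBlk.den (I.input p) = s at hexec hres
  refine ⟨s, c, hexec, hc, ?_⟩
  have hguess : ∀ A, I.IsFeasible A → ∃ a ≤ N, ∃ b ≤ N, (∃ Q, (I.table p).IsSolution
      ((I.table p).D a b) Q) ∧ ENNReal.ofReal ((I.table p).D a b) ≤ I.cost A := by
    intro A hA
    obtain ⟨a, ha, b, hb, hcov, hle⟩ := exists_covers hp hA
    exact ⟨a, ha, b, hb, exists_isSolution hp hA hcov, hle⟩
  rcases hres with ⟨hflag, hno⟩ | ⟨hflag, r, hr, ⟨Q, hout, hQ⟩, hbest⟩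
  · refine ⟨fun ⟨A, hA⟩ => ?_, fun _ => hflag⟩
    obtain ⟨a, ha, b, hb, ⟨Q, hQ⟩, -⟩ := hguess A hA
    exact (hno a ha b hb trivial Q hQ).elim
  · obtain ⟨hfeas, hcov⟩ := output_spec hp hout hQ
    refine ⟨fun _ => ⟨hflag, hfeas, hcov.cost_le.trans ?_⟩, fun h => (h ⟨_, hfeas⟩).elim⟩
    have hopt : ENNReal.ofReal r ≤ I.opt := by
      refine le_iInf₂ fun A hA => ?_
      obtain ⟨a, ha, b, hb, ⟨Q, hQ⟩, hle⟩ := hguess A hA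
      exact (ENNReal.ofReal_le_ofReal (hbest a ha b hb trivial Q hQ)).trans hle
    have hr0 : 0 ≤ r := hr ▸ I.table_metric.nonneg _ _
    calc ENNReal.ofReal (r + r + r) = 3 * ENNReal.ofReal r := by
          rw [show r + r + r = 3 * r by ring, ENNReal.ofReal_mul (by norm_num)]
          norm_num
      _ ≤ 3 * I.opt := by gcongr
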